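/- Let $G$ be a locally compact (Hausdorff) second countable unimodular amenable group with Haar measure $\lambda$. A two-sided Følner sequence of $G$ is a sequence of compact sets $F_n\subset G$ with $\lambda(F_n)>0$ such that $\lambda(KF_nK\setminus F_n)/\lambda(F_n)\to 0$ for every compact $K\subset G$. Then every two-sided Følner sequence of $G$ has a subsequence $(F_n)$ for which there are a constant $C>0$, a strictly increasing function $N:\mathbb N\to\mathbb N$, a probability measure $\omega$ on $G$ that is absolutely continuous with respect to $\lambda$, and $n_0\in\mathbb N$, all depending only on the Følner sequence, with the following property. Let $\mathcal M$ be a von Neumann algebra with a semifinite faithful normal trace $\tau$, and let $\alpha$ be an action of $G$ on $\mathcal M$ by $\tau$-preserving $*$-automorphisms such that $g\mapsto\alpha_g(x)$ is weak*-continuous for every $x\in\mathcal M$; extend $\alpha$ to the noncommutative spaces $L_p(\mathcal M)$ by isometries. Put $$T(x)=\int_G\alpha_g(x)\,d\omega(g)\qquad(x\in L_p(\mathcal M),\ p\in[1,\infty]),$$ where all integrals are Bochner integrals in $L_p(\mathcal M)$ if $p<\infty$ and weak* integrals if $p=\infty$, with $L_\infty(\mathcal M)=\mathcal M$. Then these integrals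 exist, $T$ is a positive linear map, on $\mathcal M$ it satisfies $\|T(x)\|\le\|x\|$ for all $x$, $T(x)\ge 0$ for $x\ge0$, and $\tau(T(x))\le\tau(x)$ for $x\ge 0$; and for all $p\in[1,\infty]$, all positive $x\in L_p(\mathcal M)$ and all $n\ge n_0$, $$\frac1{\lambda(F_n)}\int_{F_n}\alpha_g(x)\,d\lambda(g)\ \le\ C\,\frac1{N(n)}\sum_{j=0}^{N(n)-1}T^j(x).$$ -/

import Mathlib

open MeasureTheory Filter Topology
open scoped ENNReal NNReal Pointwise InnerProductSpace

universe u v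

/-! ### Von Neumann algebras as ordered C*-algebras -/

namespace VonNeumannAlgebra

variable {H : Type u} [NormedAddCommGroup H] [InnerProductSpace ℂ H] [CompleteSpace H]

instance instSMulMemClass : SMulMemClass (VonNeumannAlgebra H) ℂ (H →L[ℂ] H) where
  smul_mem {s} c _ hx := s.toStarSubalgebra.smul_mem hx c

theorem isClosed_coe (M : VonNeumannAlgebra H) : IsClosed (M : Set (H →L[ℂ] H)) := by
  rw [← M.centralizer_centralizer]
  exact Set.isClosed_centralizer _

noncomputable instance instCStarAlgebra (M : VonNeumannAlgebra H) : CStarAlgebra M :=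
  StarSubalgebra.cstarAlgebra M (h_closed := M.isClosed_coe)

theorem sqrt_mem (M : VonNeumannAlgebra H) {x : H →L[ℂ] H} (hx : x ∈ M) :
    CFC.sqrt x ∈ M := by
  rw [← M.commutant_commutant, mem_commutant_iff]
  intro y hy
  have hxy : Commute x y := (mem_commutant_iff.1 hy) x hx
  exact (Commute.cfcₙ_nnreal hxy NNReal.sqrt).eq.symm

/-- The order on `M` is the Loewner order of operators on `H`; its positive elements are exactly
the elements `s* s` with `s ∈ M`. -/
instance instStarOrderedRing (M : VonNeumannAlgebra H) : StarOrderedRing M :=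
  StarOrderedRing.of_nonneg_iff'
    (fun {x y} h z => by
      change (z : H →L[ℂ] H) + x ≤ (z : H →L[ℂ] H) + y
      exact add_le_add_right (show (x : H →L[ℂ] H) ≤ y from h) _)
    (fun x => by
      constructor
      · intro hx
        have hx' : (0 : H →L[ℂ] H) ≤ x := hx
        refine ⟨⟨CFC.sqrt (x : H →L[ℂ] H), M.sqrt_mem x.2⟩, Subtype.ext ?_⟩
        change (x : H →L[ℂ] H) = star (CFC.sqrt (x : H →L[ℂ] H)) * CFC.sqrt (x : H →L[ℂ] H)
        rw [(CFC.sqrt_nonneg (x : H →L[ℂ] H)).isSelfAdjoint.star_eq,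
          CFC.sqrt_mul_sqrt_self (x : H →L[ℂ] H) hx']
      · rintro ⟨s, rfl⟩
        change (0 : H →L[ℂ] H) ≤ star (s : H →L[ℂ] H) * s
        exact star_mul_self_nonneg _)

end VonNeumannAlgebra

noncomputable section

/-! ### The weak* topology -/

/-- The functionals `x ↦ ∑ᵢ ⟨ξᵢ, x ηᵢ⟩` with `∑ ‖ξᵢ‖² < ∞` and `∑ ‖ηᵢ‖² < ∞`: these are exactly the
elements of the predual of `M`, i.e. the weak*-continuous functionals on `M`. -/
def predualFunctional {H : Type u} [NormedAddCommGroup H] [InnerProductSpace ℂ H] [CompleteSpace H]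
    {M : VonNeumannAlgebra H} (ξ η : lp (fun _ : ℕ => H) 2) (x : M) : ℂ :=
  ∑' i, ⟪ξ i, (x : H →L[ℂ] H) (η i)⟫_ℂ

/-- `y = ∫ f dμ` as a weak* integral in `M`: every functional in the predual is integrable along `f`
and `y` has the corresponding values. Such a `y` is unique. -/
def IsWeakStarIntegral {H : Type u} [NormedAddCommGroup H] [InnerProductSpace ℂ H]
    [CompleteSpace H] {M : VonNeumannAlgebra H} {Ω : Type v} [MeasurableSpace Ω]
    (f : Ω → M) (μ : Measure Ω) (y : M) : Prop :=
  ∀ ξ η : lp (fun _ : ℕ => H) 2,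
    Integrable (fun s => predualFunctional ξ η (f s)) μ ∧
      predualFunctional ξ η y = ∫ s, predualFunctional ξ η (f s) ∂μ

/-! ### Traces -/

/-- A semifinite faithful normal trace on `M`. It is a function on the positive cone of `M` with
values in `[0, ∞]`; the values of `toFun` off the positive cone play no role. -/
structure SFNTrace {H : Type u} [NormedAddCommGroup H] [InnerProductSpace ℂ H] [CompleteSpace H]
    (M : VonNeumannAlgebra H) where
  toFun : M → ℝ≥0∞
  map_add' : ∀ x y : M, 0 ≤ x → 0 ≤ y → toFun (x + y) = toFun x + toFun y
  map_smul' : ∀ (r : ℝ≥0) (x : M), 0 ≤ x → toFun (((r : ℝ) : ℂ) • x) = r * toFun x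
  map_star_mul_self' : ∀ x : M, toFun (star x * x) = toFun (x * star x)
  faithful' : ∀ x : M, 0 ≤ x → toFun x = 0 → x = 0
  /-- Normality: suprema of bounded increasing nets of positive elements are preserved. -/
  normal' : ∀ (D : Set M) (x : M), D.Nonempty → DirectedOn (· ≤ ·) D → (∀ d ∈ D, 0 ≤ d) →
    IsLUB D x → toFun x = ⨆ d ∈ D, toFun d
  semifinite' : ∀ x : M, 0 ≤ x → x ≠ 0 → ∃ y : M, 0 ≤ y ∧ y ≤ x ∧ y ≠ 0 ∧ toFun y < ∞

namespace SFNTrace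

variable {H : Type u} [NormedAddCommGroup H] [InnerProductSpace ℂ H] [CompleteSpace H]
  {M : VonNeumannAlgebra H}

instance instCoeFun : CoeFun (SFNTrace M) (fun _ => M → ℝ≥0∞) := ⟨toFun⟩

/-! ### Noncommutative `L_p`-spaces -/

/-- `S₊`: the positive `x ∈ M` whose support projection has finite trace. The support projection is
the smallest projection `e ∈ M` with `e x = x`, so its trace is finite if and only if the trace of
some projection `e ∈ M` with `e x = x` is finite. -/
def finSuppPos (τ : SFNTrace M) : Set M :=
  {x | 0 ≤ x ∧ ∃ e : M, IsStarProjection e ∧ e * x = x ∧ τ e < ∞}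

/-- `S`: the linear span of `S₊`. -/
def finSupp (τ : SFNTrace M) : Submodule ℂ M :=
  Submodule.span ℂ τ.finSuppPos

/-- `‖x‖_p = τ(|x|^p)^{1/p}`. -/
def lpNorm (τ : SFNTrace M) (p : ℝ) (x : M) : ℝ :=
  (τ (CFC.abs x ^ p)).toReal ^ (1 / p)

/-- `‖·‖_p` as a seminorm on `S`, for `1 ≤ p < ∞`, namely the largest seminorm that is at most
`‖·‖_p`. Since `‖·‖_p` is itself a norm on `S` (Minkowski's inequality), it is its own
largest minorant, so that this is `‖·‖_p`; in this form the triangle inequality holds by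
construction. -/
def lpSeminorm (τ : SFNTrace M) (p : ℝ) : Seminorm ℂ τ.finSupp :=
  sSup {q : Seminorm ℂ τ.finSupp | ∀ x, q x ≤ τ.lpNorm p x}

/-- If `‖·‖_p` is a seminorm on `S`, then `lpSeminorm` is equal to it. -/
theorem lpSeminorm_eq_lpNorm (τ : SFNTrace M) (p : ℝ) (q₀ : Seminorm ℂ τ.finSupp)
    (h : ∀ x, q₀ x = τ.lpNorm p x) (x : τ.finSupp) : τ.lpSeminorm p x = τ.lpNorm p x := by
  have hb : BddAbove {q : Seminorm ℂ τ.finSupp | ∀ y, q y ≤ τ.lpNorm p y} :=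
    ⟨q₀, fun q hq y => (hq y).trans_eq (h y).symm⟩
  have hm : q₀ ∈ {q : Seminorm ℂ τ.finSupp | ∀ y, q y ≤ τ.lpNorm p y} := fun y => (h y).le
  have hg : IsGreatest {q : Seminorm ℂ τ.finSupp | ∀ y, q y ≤ τ.lpNorm p y} q₀ :=
    ⟨hm, fun q hq y => (hq y).trans_eq (h y).symm⟩
  have : τ.lpSeminorm p = q₀ := le_antisymm (csSup_le ⟨q₀, hm⟩ hg.2) (le_csSup hb hm)
  rw [this, h]

/-- `S` equipped with `‖·‖_p`. -/
def LpCore (τ : SFNTrace M) (_p : ℝ) : Type u := τ.finSupp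

instance instLpCoreAddCommGroup (τ : SFNTrace M) (p : ℝ) : AddCommGroup (τ.LpCore p) :=
  inferInstanceAs (AddCommGroup τ.finSupp)

instance instLpCoreModule (τ : SFNTrace M) (p : ℝ) : Module ℂ (τ.LpCore p) :=
  inferInstanceAs (Module ℂ τ.finSupp)

instance instLpCoreSeminormedAddCommGroup (τ : SFNTrace M) (p : ℝ) :
    SeminormedAddCommGroup (τ.LpCore p) :=
  AddGroupSeminorm.toSeminormedAddCommGroup
    (show Seminorm ℂ (τ.LpCore p) from τ.lpSeminorm p).toAddGroupSeminorm

instance instLpCoreNormedSpace (τ : SFNTrace M) (p : ℝ) : NormedSpace ℂ (τ.LpCore p) where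
  norm_smul_le c x := le_of_eq
    (map_smul_eq_mul (show Seminorm ℂ (τ.LpCore p) from τ.lpSeminorm p) c x)

/-- The identity map from `S` to `S` equipped with `‖·‖_p`. -/
def toLpCore (τ : SFNTrace M) (p : ℝ) : τ.finSupp ≃ₗ[ℂ] τ.LpCore p :=
  LinearEquiv.refl ℂ τ.finSupp

/-- `L_p(M)` for `1 ≤ p < ∞`: the completion of `S` for `‖·‖_p`. -/
abbrev Lp (τ : SFNTrace M) (p : ℝ) : Type u := UniformSpace.Completion (τ.LpCore p)

/-- The inclusion `S → L_p(M)`. -/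
def toLp (τ : SFNTrace M) (p : ℝ) (x : τ.finSupp) : τ.Lp p :=
  ((τ.toLpCore p x : τ.LpCore p) : UniformSpace.Completion (τ.LpCore p))

/-- `L_p^+(M)`, the closure of the positive elements of `S`. -/
def LpPos (τ : SFNTrace M) (p : ℝ) : Set (τ.Lp p) :=
  closure (τ.toLp p '' {x | 0 ≤ (x : M)})

/-- The order of `L_p(M)`. -/
def LpLE (τ : SFNTrace M) (p : ℝ) (a b : τ.Lp p) : Prop := b - a ∈ τ.LpPos p

end SFNTrace

/-! ### Trace-preserving actions -/

/-- A weak*-continuous trace-preserving action of `G` on `(M, τ)` by `*`-automorphisms. -/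
structure TracePreservingAction (G : Type v) [Group G] [TopologicalSpace G] {H : Type u}
    [NormedAddCommGroup H] [InnerProductSpace ℂ H] [CompleteSpace H] {M : VonNeumannAlgebra H}
    (τ : SFNTrace M) where
  toHom : G →* (M ≃⋆ₐ[ℂ] M)
  trace_map' : ∀ (g : G) (x : M), 0 ≤ x → τ (toHom g x) = τ x
  continuous' : ∀ (x : M) (ξ η : lp (fun _ : ℕ => H) 2),
    Continuous fun g => predualFunctional ξ η (toHom g x)

namespace TracePreservingAction

variable {G : Type v} [Group G] [TopologicalSpace G] {H : Type u}
  [NormedAddCommGroup H] [InnerProductSpace ℂ H] [CompleteSpace H] {M : VonNeumannAlgebra H}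
  {τ : SFNTrace M}

instance instCoeFun : CoeFun (TracePreservingAction G τ) (fun _ => G → (M ≃⋆ₐ[ℂ] M)) :=
  ⟨fun α => α.toHom⟩

theorem map_nonneg (α : TracePreservingAction G τ) (g : G) {x : M} (hx : 0 ≤ x) : 0 ≤ α g x := by
  obtain ⟨s, rfl⟩ := (CStarAlgebra.nonneg_iff_eq_star_mul_self).1 hx
  rw [map_mul, map_star]
  exact star_mul_self_nonneg _

theorem map_finSupp (α : TracePreservingAction G τ) (g : G) {x : M} (hx : x ∈ τ.finSupp) :
    α g x ∈ τ.finSupp := by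
  induction hx using Submodule.span_induction with
  | mem x hx =>
    obtain ⟨hx0, e, he, hex, hτ⟩ := hx
    refine Submodule.subset_span ⟨α.map_nonneg g hx0, α g e, he.map (α g), ?_, ?_⟩
    · rw [← map_mul, hex]
    · rwa [α.trace_map' g e he.nonneg]
  | zero => simp
  | add x y _ _ hx hy => rw [map_add]; exact add_mem hx hy
  | smul c x _ hx => rw [map_smul]; exact Submodule.smul_mem _ c hx

theorem map_abs (α : TracePreservingAction G τ) (g : G) (x : M) :
    α g (CFC.abs x) = CFC.abs (α g x) := by
  refine (CFC.sqrt_unique ?_ (α.map_nonneg g (CFC.abs_nonneg x))).symm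
  rw [← map_mul, CFC.abs_mul_abs, map_mul, map_star]

theorem map_rpow (α : TracePreservingAction G τ) (g : G) {x : M} (hx : 0 ≤ x) (p : ℝ) :
    α g (x ^ p) = (α g x) ^ p := by
  have hsp : spectrum ℝ≥0 (α g x) = spectrum ℝ≥0 x :=
    AlgEquiv.spectrum_eq ((α g : M ≃⋆ₐ[ℂ] M).toAlgEquiv.restrictScalars ℝ≥0) x
  rw [CFC.rpow_def, CFC.rpow_def]
  by_cases hf : ContinuousOn (fun t : ℝ≥0 => t ^ p) (spectrum ℝ≥0 x)
  · exact StarAlgHomClass.map_cfc (S := ℂ) (α g) _ x hf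
      (StarAlgEquiv.isometry (α g)).continuous hx (α.map_nonneg g hx)
  · rw [cfc_apply_of_not_continuousOn _ hf, cfc_apply_of_not_continuousOn _ (by rwa [hsp]),
      map_zero]

theorem lpNorm_map (α : TracePreservingAction G τ) (p : ℝ) (g : G) (x : M) :
    τ.lpNorm p (α g x) = τ.lpNorm p x := by
  rw [SFNTrace.lpNorm, ← α.map_abs, ← α.map_rpow g (CFC.abs_nonneg x),
    α.trace_map' g _ CFC.rpow_nonneg, SFNTrace.lpNorm]

/-- The restriction of `α_g` to `S`. -/
def coreMap (α : TracePreservingAction G τ) (g : G) : τ.finSupp →ₗ[ℂ] τ.finSupp where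
  toFun x := ⟨α g x, α.map_finSupp g x.2⟩
  map_add' x y := Subtype.ext (map_add (α g) (x : M) y)
  map_smul' c x := Subtype.ext (map_smul (α g) c (x : M))

theorem lpSeminorm_coreMap_le (α : TracePreservingAction G τ) (p : ℝ) (g : G) (x : τ.finSupp) :
    τ.lpSeminorm p (α.coreMap g x) ≤ τ.lpSeminorm p x := by
  have hb : BddAbove {q : Seminorm ℂ τ.finSupp | ∀ y, q y ≤ τ.lpNorm p y} :=
    Seminorm.bddAbove_iff.2 ⟨fun y => τ.lpNorm p y, by rintro _ ⟨q, hq, rfl⟩ y; exact hq y⟩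
  have hne : Nonempty {q : Seminorm ℂ τ.finSupp | ∀ y, q y ≤ τ.lpNorm p y} :=
    ⟨⟨0, fun y => Real.rpow_nonneg ENNReal.toReal_nonneg _⟩⟩
  rw [SFNTrace.lpSeminorm, Seminorm.sSup_apply hb, Seminorm.sSup_apply hb]
  refine ciSup_le fun q => ?_
  have hq : ∀ y, (q.1.comp (α.coreMap g)) y ≤ τ.lpNorm p y := fun y =>
    (q.2 (α.coreMap g y)).trans_eq (α.lpNorm_map p g y)
  exact le_ciSup (f := fun q : {q : Seminorm ℂ τ.finSupp | ∀ y, q y ≤ τ.lpNorm p y} => q.1 x)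
    ⟨τ.lpNorm p x, by rintro _ ⟨q, rfl⟩; exact q.2 x⟩ ⟨q.1.comp (α.coreMap g), hq⟩

/-- The restriction of `α_g` to `S`, as a bounded operator for `‖·‖_p`. -/
def lpCoreMap (α : TracePreservingAction G τ) (p : ℝ) (g : G) : τ.LpCore p →L[ℂ] τ.LpCore p :=
  LinearMap.mkContinuous
    (((τ.toLpCore p).toLinearMap ∘ₗ α.coreMap g) ∘ₗ (τ.toLpCore p).symm.toLinearMap) 1
    (fun x => by rw [one_mul]; exact α.lpSeminorm_coreMap_le p g x)

/-- The action of `G` on `L_p(M)`: the continuous extension of `α_g` from `S` to `L_p(M)`. -/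
def onLp (α : TracePreservingAction G τ) (p : ℝ) (g : G) : τ.Lp p →L[ℂ] τ.Lp p :=
  (α.lpCoreMap p g).completion

end TracePreservingAction

/-! ### Følner sequences -/

/-- A two-sided Følner sequence: compact sets `F n` of positive measure such that
`|K (F n) K \ F n| / |F n| → 0` for every compact `K`. -/
structure IsTwoSidedFolner {G : Type v} [Group G] [TopologicalSpace G] [MeasurableSpace G]
    (lam : Measure G) (F : ℕ → Set G) : Prop where
  isCompact : ∀ n, IsCompact (F n)
  measure_pos : ∀ n, 0 < lam (F n)
  tendsto : ∀ K : Set G, IsCompact K →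
    Tendsto (fun n => lam ((K * F n * K) \ F n) / lam (F n)) atTop (𝓝 0)

end

/-!
The inequality holds because it already holds for measures on `G`. Let
`ω = ∑ₖ 2^{-(k+1)} νₖ`, where `νₖ` is the uniform measure on an enlargement `F'ₖ` of the `k`-th
set of a sparse subsequence of the Følner sequence. A product of fewer than `N = 2ⁿ` independent
`ω`-distributed elements has, with probability bounded below for most lengths, exactly one factor
with index `n` and all others with smaller index. The other factors range over a compact set `K`
that was fixed before `Fₙ` was chosen, so the two-sided Følner property allows
`F'ₙ = K^N Fₙ K^N` with `λ(F'ₙ) ≤ 2 λ(Fₙ)`; since `λ` is invariant on both sides, the factor that is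
uniform on `F'ₙ` makes the density of the product at least a constant over `λ(Fₙ)` on `Fₙ`. Hence
`λ|Fₙ ≤ C (λ(Fₙ) / N) ∑_{j<N} ω^{*j}` (`IsTwoSidedFolner.exists_restrict_le_convPow`), and
integrating `g ↦ α_g(x)` against both sides gives the theorem, because `T^j` is the average over
`ω^{*j}`.

On `M`, identifying `T^j` with the average over `ω^{*j}` requires moving `α_g` under a weak*
integral, and `τ ∘ T ≤ τ` requires the same for compressions `z ↦ τ(c z c)` of the trace. Both
reduce to the fact that a positive functional preserving suprema of bounded increasing nets belongs
to the predual (`VonNeumannAlgebra.IsOrderNormal.exists_mem_predual`), which is proved by two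
applications of Zorn's lemma to positive elements, without spectral projections.

On `L_p(M)` the integrals are Bochner integrals once `g ↦ α_g(x)` is known to be continuous in norm.
For `x = s²` in `S₊`, weak* continuity and invariance of the trace give
`τ((α_g(s) - s)²) → 0` (`TracePreservingAction.tendsto_trace_sub_mul_self`), from which
`τ(|α_g(x) - x|) → 0` and then `τ(|α_g(x) - x|^p) → 0` follow by operator inequalities. Since the
norm of `S` in the definition of `L_p(M)` is the largest seminorm below `τ(|x|^p)^{1/p}`, an upper
bound for the latter is enough, and Minkowski's inequality is not needed.
-/

open scoped ComplexOrder

namespace VonNeumannAlgebra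

/-! ### Weak limits, weak integrals and suprema in a von Neumann algebra -/

section Weak

variable {H : Type u} [NormedAddCommGroup H] [InnerProductSpace ℂ H] [CompleteSpace H]
  {M : VonNeumannAlgebra H}

theorem nonneg_iff_inner {x : M} :
    0 ≤ x ↔ ∀ ξ : H, 0 ≤ ⟪ξ, (x : H →L[ℂ] H) ξ⟫_ℂ := by
  have h : 0 ≤ x ↔ (0 : H →L[ℂ] H) ≤ x := Iff.rfl
  rw [h, ContinuousLinearMap.nonneg_iff_isPositive]
  constructor
  · intro hx ξ
    exact hx.inner_nonneg_right ξ
  · intro hx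
    rw [ContinuousLinearMap.isPositive_iff_complex]
    intro ξ
    have h1 := hx ξ
    rw [← inner_conj_symm] at h1
    rw [RCLike.nonneg_iff] at h1
    simp only [RCLike.conj_re, RCLike.conj_im, neg_eq_zero] at h1
    refine ⟨?_, h1.1⟩
    apply Complex.ext
    · simp
    · simpa using h1.2.symm

theorem le_iff_inner {x y : M} :
    x ≤ y ↔ ∀ ξ : H, ⟪ξ, (x : H →L[ℂ] H) ξ⟫_ℂ ≤ ⟪ξ, (y : H →L[ℂ] H) ξ⟫_ℂ := by
  rw [← sub_nonneg, nonneg_iff_inner]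
  refine forall_congr' fun ξ => ?_
  rw [← sub_nonneg (a := ⟪ξ, (y : H →L[ℂ] H) ξ⟫_ℂ), ← inner_sub_right]
  rfl

theorem ext_inner {x y : M}
    (h : ∀ ξ : H, ⟪ξ, (x : H →L[ℂ] H) ξ⟫_ℂ = ⟪ξ, (y : H →L[ℂ] H) ξ⟫_ℂ) : x = y :=
  le_antisymm (le_iff_inner.2 fun ξ => (h ξ).le) (le_iff_inner.2 fun ξ => (h ξ).ge)

/-- A bounded sesquilinear form that commutes with the commutant of `M` is given by an element
of `M`; this is the double commutant property. -/
theorem exists_of_sesquilinear (B : H →ₗ⋆[ℂ] H →ₗ[ℂ] ℂ) (C : ℝ)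
    (hC : ∀ ξ η, ‖B ξ η‖ ≤ C * ‖ξ‖ * ‖η‖)
    (hcomm : ∀ c ∈ M.commutant, ∀ ξ η, B ξ (c η) = B (star c ξ) η) :
    ∃ y : M, ∀ ξ η, ⟪ξ, (y : H →L[ℂ] H) η⟫_ℂ = B ξ η := by
  let B' := B.mkContinuous₂ C hC
  let y := ContinuousLinearMap.adjoint (InnerProductSpace.continuousLinearMapOfBilin B')
  have hy : ∀ ξ η, ⟪ξ, y η⟫_ℂ = B ξ η := by
    intro ξ η
    exact (ContinuousLinearMap.adjoint_inner_right _ ξ η).trans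
      (InnerProductSpace.continuousLinearMapOfBilin_apply B' ξ η)
  refine ⟨⟨y, ?_⟩, hy⟩
  rw [← M.commutant_commutant, mem_commutant_iff]
  intro c hc
  ext η
  refine ext_inner_left ℂ fun ξ => ?_
  calc ⟪ξ, c (y η)⟫_ℂ = ⟪star c ξ, y η⟫_ℂ := by
        rw [ContinuousLinearMap.star_eq_adjoint, ContinuousLinearMap.adjoint_inner_left]
    _ = ⟪ξ, y (c η)⟫_ℂ := by rw [hy, hy, hcomm c hc]

theorem inner_commutant (x : M) {c : H →L[ℂ] H} (hc : c ∈ M.commutant) (ξ η : H) :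
    ⟪ξ, (x : H →L[ℂ] H) (c η)⟫_ℂ = ⟪star c ξ, (x : H →L[ℂ] H) η⟫_ℂ := by
  rw [ContinuousLinearMap.star_eq_adjoint, ContinuousLinearMap.adjoint_inner_left]
  have := (mem_commutant_iff.1 hc) x x.2
  exact congrArg (fun T : H →L[ℂ] H => ⟪ξ, T η⟫_ℂ) this

theorem norm_inner_apply_le (x : M) (ξ η : H) :
    ‖⟪ξ, (x : H →L[ℂ] H) η⟫_ℂ‖ ≤ ‖x‖ * ‖ξ‖ * ‖η‖ := by
  calc ‖⟪ξ, (x : H →L[ℂ] H) η⟫_ℂ‖ ≤ ‖ξ‖ * ‖(x : H →L[ℂ] H) η‖ := norm_inner_le_norm _ _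
    _ ≤ ‖ξ‖ * (‖x‖ * ‖η‖) := by
        gcongr
        exact (x : H →L[ℂ] H).le_opNorm η
    _ = ‖x‖ * ‖ξ‖ * ‖η‖ := by ring

/-- Norm-bounded families in `M` converge weakly along every ultrafilter. -/
theorem exists_tendsto_inner {ι : Type*} (U : Ultrafilter ι) (f : ι → M) (C : ℝ)
    (hf : ∀ i, ‖f i‖ ≤ C) :
    ∃ y : M, ∀ ξ η : H, Tendsto (fun i => ⟪ξ, (f i : H →L[ℂ] H) η⟫_ℂ) U
      (𝓝 ⟪ξ, (y : H →L[ℂ] H) η⟫_ℂ) := by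
  have hb : ∀ (ξ η : H) i, ‖⟪ξ, (f i : H →L[ℂ] H) η⟫_ℂ‖ ≤ C * ‖ξ‖ * ‖η‖ := fun ξ η i =>
    (norm_inner_apply_le _ ξ η).trans (by gcongr; exact hf i)
  have hlim : ∀ ξ η : H, ∃ z : ℂ, ‖z‖ ≤ C * ‖ξ‖ * ‖η‖ ∧
      Tendsto (fun i => ⟪ξ, (f i : H →L[ℂ] H) η⟫_ℂ) U (𝓝 z) := by
    intro ξ η
    obtain ⟨z, hz, hzt⟩ := (isCompact_closedBall (0 : ℂ) (C * ‖ξ‖ * ‖η‖)).ultrafilter_le_nhds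
      (U.map fun i => ⟪ξ, (f i : H →L[ℂ] H) η⟫_ℂ)
      (by
        rw [le_principal_iff, Ultrafilter.coe_map, mem_map]
        exact Eventually.of_forall fun i => by simpa using hb ξ η i)
    exact ⟨z, by simpa using hz, hzt⟩
  choose B hBn hBt using hlim
  let B' : H →ₗ⋆[ℂ] H →ₗ[ℂ] ℂ := LinearMap.mk₂'ₛₗ (starRingEnd ℂ) (RingHom.id ℂ) B
    (fun ξ ξ' η => tendsto_nhds_unique (hBt _ _) (by
      simpa only [inner_add_left] using (hBt ξ η).add (hBt ξ' η)))
    (fun c ξ η => tendsto_nhds_unique (hBt _ _) (by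
      simpa only [inner_smul_left, smul_eq_mul] using (hBt ξ η).const_mul _))
    (fun ξ η η' => tendsto_nhds_unique (hBt _ _) (by
      simpa only [map_add, inner_add_right] using (hBt ξ η).add (hBt ξ η')))
    (fun c ξ η => tendsto_nhds_unique (hBt _ _) (by
      simpa only [map_smul, inner_smul_right, RingHom.id_apply, smul_eq_mul]
        using (hBt ξ η).const_mul c))
  obtain ⟨y, hy⟩ := exists_of_sesquilinear (M := M) B' C hBn (fun c hc ξ η =>
    tendsto_nhds_unique (hBt _ _) (by
      simpa only [inner_commutant _ hc] using! hBt (star c ξ) η))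
  exact ⟨y, fun ξ η => by rw [hy]; exact hBt ξ η⟩

/-- The weak integral of a bounded weakly measurable function for a finite measure. -/
theorem exists_inner_eq_integral {Ω : Type*} [MeasurableSpace Ω] (μ : Measure Ω)
    [IsFiniteMeasure μ] (f : Ω → M) (C : ℝ) (hf : ∀ s, ‖f s‖ ≤ C)
    (hm : ∀ ξ η : H, AEStronglyMeasurable (fun s => ⟪ξ, (f s : H →L[ℂ] H) η⟫_ℂ) μ) :
    ∃ y : M, ∀ ξ η : H,
      ⟪ξ, (y : H →L[ℂ] H) η⟫_ℂ = ∫ s, ⟪ξ, (f s : H →L[ℂ] H) η⟫_ℂ ∂μ := by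
  have hb : ∀ (ξ η : H) s, ‖⟪ξ, (f s : H →L[ℂ] H) η⟫_ℂ‖ ≤ C * ‖ξ‖ * ‖η‖ := fun ξ η i =>
    (norm_inner_apply_le _ ξ η).trans (by gcongr; exact hf i)
  have hi : ∀ ξ η : H, Integrable (fun s => ⟪ξ, (f s : H →L[ℂ] H) η⟫_ℂ) μ := fun ξ η =>
    Integrable.of_bound (hm ξ η) _ (Eventually.of_forall (hb ξ η))
  let B : H →ₗ⋆[ℂ] H →ₗ[ℂ] ℂ := LinearMap.mk₂'ₛₗ (starRingEnd ℂ) (RingHom.id ℂ)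
    (fun ξ η => ∫ s, ⟪ξ, (f s : H →L[ℂ] H) η⟫_ℂ ∂μ)
    (fun ξ ξ' η => by simp only [inner_add_left]; exact integral_add (hi _ _) (hi _ _))
    (fun c ξ η => by simp only [inner_smul_left]; exact integral_const_mul _ _)
    (fun ξ η η' => by
      simp only [map_add, inner_add_right]; exact integral_add (hi _ _) (hi _ _))
    (fun c ξ η => by simp only [map_smul, inner_smul_right]; exact integral_const_mul _ _)
  refine exists_of_sesquilinear B (C * μ.real Set.univ) (fun ξ η => ?_) (fun c hc ξ η => ?_)
  · calc ‖∫ s, ⟪ξ, (f s : H →L[ℂ] H) η⟫_ℂ ∂μ‖ ≤ (C * ‖ξ‖ * ‖η‖) * μ.real Set.univ :=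
          norm_integral_le_of_norm_le_const (Eventually.of_forall (hb ξ η))
      _ = _ := by ring
  · exact integral_congr_ae (Eventually.of_forall fun s => inner_commutant _ hc ξ η)

theorem norm_le_of_nonneg_of_le {x y : M} (hx : 0 ≤ x) (h : x ≤ y) : ‖x‖ ≤ ‖y‖ :=
  CStarAlgebra.norm_le_norm_of_nonneg_of_le hx h

/-- Bounded increasing nets of positive elements have a supremum in `M`, and it is their weak
limit. -/
theorem exists_isLUB {D : Set M} (hne : D.Nonempty) (hdir : DirectedOn (· ≤ ·) D)
    (hpos : ∀ d ∈ D, 0 ≤ d) (hb : BddAbove D) :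
    ∃ s : M, IsLUB D s ∧ ∀ ξ : H, IsLUB ((fun d : M => ⟪ξ, (d : H →L[ℂ] H) ξ⟫_ℂ) '' D)
      ⟪ξ, (s : H →L[ℂ] H) ξ⟫_ℂ := by
  obtain ⟨w, hw⟩ := hb
  have : Nonempty D := hne.to_subtype
  have : IsDirectedOrder D := ⟨fun a b => by
    obtain ⟨c, hc, hac, hbc⟩ := hdir a a.2 b b.2
    exact ⟨⟨c, hc⟩, hac, hbc⟩⟩
  let U := Ultrafilter.of (atTop : Filter D)
  obtain ⟨s, hs⟩ := exists_tendsto_inner U (fun d : D => (d : M)) ‖w‖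
    (fun d => norm_le_of_nonneg_of_le (hpos d d.2) (hw d.2))
  have hub : ∀ d ∈ D, ∀ ξ : H, ⟪ξ, (d : H →L[ℂ] H) ξ⟫_ℂ ≤ ⟪ξ, (s : H →L[ℂ] H) ξ⟫_ℂ := by
    intro d hd ξ
    refine ge_of_tendsto (hs ξ ξ) ?_
    have : ∀ᶠ e : D in atTop, ⟪ξ, (d : H →L[ℂ] H) ξ⟫_ℂ ≤ ⟪ξ, ((e : M) : H →L[ℂ] H) ξ⟫_ℂ := by
      filter_upwards [eventually_ge_atTop (⟨d, hd⟩ : D)] with e he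
      exact le_iff_inner.1 he ξ
    exact Ultrafilter.of_le _ this
  refine ⟨s, ⟨fun d hd => le_iff_inner.2 (hub d hd), fun y hy => le_iff_inner.2 fun ξ => ?_⟩,
    fun ξ => ⟨?_, fun y hy => ?_⟩⟩
  · exact le_of_tendsto (hs ξ ξ) (Eventually.of_forall fun d => le_iff_inner.1 (hy d.2) ξ)
  · rintro _ ⟨d, hd, rfl⟩
    exact hub d hd ξ
  · exact le_of_tendsto (hs ξ ξ) (Eventually.of_forall fun d => hy ⟨d, d.2, rfl⟩)

theorem isLUB_inner {D : Set M} {x : M} (hne : D.Nonempty) (hdir : DirectedOn (· ≤ ·) D)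
    (hpos : ∀ d ∈ D, 0 ≤ d) (hx : IsLUB D x) (ξ : H) :
    IsLUB ((fun d : M => ⟪ξ, (d : H →L[ℂ] H) ξ⟫_ℂ) '' D) ⟪ξ, (x : H →L[ℂ] H) ξ⟫_ℂ := by
  obtain ⟨s, hs, h⟩ := exists_isLUB hne hdir hpos ⟨x, hx.1⟩
  rw [hx.unique hs]
  exact h ξ

theorem directedOn_conjugate {D : Set M} (hdir : DirectedOn (· ≤ ·) D) (c : M) :
    DirectedOn (· ≤ ·) ((fun d : M => star c * d * c) '' D) := by
  rintro _ ⟨a, ha, rfl⟩ _ ⟨b, hb, rfl⟩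
  obtain ⟨e, he, hae, hbe⟩ := hdir a ha b hb
  exact ⟨_, ⟨e, he, rfl⟩, star_left_conjugate_le_conjugate hae c,
    star_left_conjugate_le_conjugate hbe c⟩

theorem isLUB_conjugate {D : Set M} {x : M} (hne : D.Nonempty) (hdir : DirectedOn (· ≤ ·) D)
    (hpos : ∀ d ∈ D, 0 ≤ d) (hx : IsLUB D x) (c : M) :
    IsLUB ((fun d : M => star c * d * c) '' D) (star c * x * c) := by
  have key : ∀ (z : M) (ξ : H), ⟪ξ, ((star c * z * c : M) : H →L[ℂ] H) ξ⟫_ℂ =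
      ⟪(c : H →L[ℂ] H) ξ, (z : H →L[ℂ] H) ((c : H →L[ℂ] H) ξ)⟫_ℂ := fun z ξ =>
    ContinuousLinearMap.adjoint_inner_right (c : H →L[ℂ] H) ξ _
  constructor
  · rintro _ ⟨d, hd, rfl⟩
    exact star_left_conjugate_le_conjugate (hx.1 hd) c
  · intro y hy
    rw [le_iff_inner]
    intro ξ
    rw [key]
    refine (isLUB_inner hne hdir hpos hx _).2 ?_
    rintro _ ⟨d, hd, rfl⟩
    have := le_iff_inner.1 (hy ⟨d, hd, rfl⟩) ξ
    rwa [key] at this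

end Weak

end VonNeumannAlgebra

namespace VonNeumannAlgebra

/-! ### The predual and automatic weak* continuity of order-normal functionals -/

section Predual

variable {H : Type u} [NormedAddCommGroup H] [InnerProductSpace ℂ H] [CompleteSpace H]

/-- The vector functional `x ↦ ⟨ξ, x η⟩` on `M`. -/
noncomputable def vecFunctional (M : VonNeumannAlgebra H) (ξ η : H) : M →L[ℂ] ℂ :=
  LinearMap.mkContinuous
    { toFun := fun x => ⟪ξ, (x : H →L[ℂ] H) η⟫_ℂ
      map_add' := fun x y => inner_add_right ξ ((x : H →L[ℂ] H) η) ((y : H →L[ℂ] H) η)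
      map_smul' := fun c x => inner_smul_right ξ ((x : H →L[ℂ] H) η) c }
    (‖ξ‖ * ‖η‖) (fun x => (norm_inner_apply_le x ξ η).trans_eq (by ring))

/-- The predual of `M`: the norm closure in the dual of the span of the vector functionals. -/
noncomputable def predual (M : VonNeumannAlgebra H) : Submodule ℂ (M →L[ℂ] ℂ) :=
  (Submodule.span ℂ (Set.range fun p : H × H => vecFunctional M p.1 p.2)).topologicalClosure

variable {M : VonNeumannAlgebra H}

theorem isClosed_predual : IsClosed (predual M : Set (M →L[ℂ] ℂ)) :=
  Submodule.isClosed_topologicalClosure _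

theorem vecFunctional_mem_predual (ξ η : H) : vecFunctional M ξ η ∈ predual M :=
  Submodule.le_topologicalClosure _ (Submodule.subset_span ⟨(ξ, η), rfl⟩)

theorem predual_le {W : Submodule ℂ (M →L[ℂ] ℂ)} (hW : IsClosed (W : Set (M →L[ℂ] ℂ)))
    (h : ∀ ξ η, vecFunctional M ξ η ∈ W) : predual M ≤ W := by
  refine Submodule.topologicalClosure_minimal _ (Submodule.span_le.2 ?_) hW
  rintro _ ⟨p, rfl⟩
  exact h p.1 p.2

theorem comp_mul_right_mem_predual (d : M) {f : M →L[ℂ] ℂ} (hf : f ∈ predual M) :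
    f ∘L (ContinuousLinearMap.mul ℂ M).flip d ∈ predual M := by
  let P : (M →L[ℂ] ℂ) →L[ℂ] (M →L[ℂ] ℂ) :=
    (ContinuousLinearMap.compL ℂ M M ℂ).flip ((ContinuousLinearMap.mul ℂ M).flip d)
  have h : predual M ≤ (predual M).comap (P : (M →L[ℂ] ℂ) →ₗ[ℂ] (M →L[ℂ] ℂ)) := by
    refine predual_le (isClosed_predual.preimage P.continuous) fun ξ η => ?_
    exact vecFunctional_mem_predual (M := M) ξ ((d : H →L[ℂ] H) η)
  exact h hf

theorem exists_inner_eq_of_norm_le {E : Type*} [AddCommGroup E] [Module ℂ E] (f : E →ₗ[ℂ] ℂ)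
    (L : E →ₗ[ℂ] H) (C : ℝ) (h : ∀ x, ‖f x‖ ≤ C * ‖L x‖) : ∃ η : H, ∀ x, f x = ⟪η, L x⟫_ℂ := by
  have hker : LinearMap.ker L ≤ LinearMap.ker f := by
    intro x hx
    have := h x
    rw [LinearMap.mem_ker.1 hx, norm_zero, mul_zero] at this
    exact norm_le_zero_iff.1 this
  let f' : LinearMap.range L →ₗ[ℂ] ℂ :=
    (LinearMap.ker L).liftQ f hker ∘ₗ L.quotKerEquivRange.symm.toLinearMap
  have hf' : ∀ x, f' ⟨L x, x, rfl⟩ = f x := by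
    intro x
    have : L.quotKerEquivRange.symm ⟨L x, x, rfl⟩ = (LinearMap.ker L).mkQ x := by
      rw [LinearEquiv.symm_apply_eq]
      rfl
    simp [f', this]
  obtain ⟨g, hg, -⟩ := exists_extension_norm_eq (LinearMap.range L) (f'.mkContinuous C (by
    rintro ⟨_, x, rfl⟩
    rw [hf']
    exact h x))
  refine ⟨(InnerProductSpace.toDual ℂ H).symm g, fun x => ?_⟩
  rw [InnerProductSpace.toDual_symm_apply, ← hf' x]
  exact (hg ⟨L x, x, rfl⟩).symm

/-- A positive functional is order-normal if it preserves suprema of bounded increasing nets of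
positive elements. -/
def IsOrderNormal (φ : M →ₚ[ℂ] ℂ) : Prop :=
  ∀ (D : Set M) (x : M), D.Nonempty → DirectedOn (· ≤ ·) D → (∀ d ∈ D, 0 ≤ d) → IsLUB D x →
    IsLUB (φ '' D) (φ x)

theorem IsOrderNormal.exists_re_sub_lt {φ : M →ₚ[ℂ] ℂ} (hφ : IsOrderNormal φ) {D : Set M} {x : M}
    (hne : D.Nonempty) (hdir : DirectedOn (· ≤ ·) D) (hpos : ∀ d ∈ D, 0 ≤ d) (hx : IsLUB D x)
    {ε : ℝ} (hε : 0 < ε) : ∃ d ∈ D, (φ (x - d)).re < ε := by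
  by_contra! hcon
  have h : φ x ≤ φ x - (ε : ℂ) := (hφ D x hne hdir hpos hx).2 (by
    rintro _ ⟨d, hd, rfl⟩
    have h1 := hcon d hd
    have h2 : φ d ≤ φ x := OrderHomClass.mono φ (hx.1 hd)
    rw [map_sub, Complex.sub_re] at h1
    rw [Complex.le_def] at h2 ⊢
    simp only [Complex.sub_re, Complex.ofReal_re, Complex.sub_im, Complex.ofReal_im, sub_zero]
    exact ⟨by linarith, h2.2⟩)
  have := (Complex.le_def.1 h).1
  simp only [Complex.sub_re, Complex.ofReal_re] at this
  linarith

/-- The Cauchy–Schwarz inequality for a positive functional. -/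
theorem norm_map_star_mul_le (φ : M →ₚ[ℂ] ℂ) (a b : M) :
    ‖φ (star a * b)‖ ≤ √(φ (star a * a)).re * √(φ (star b * b)).re :=
  norm_inner_le_norm (𝕜 := ℂ) (φ.toPreGNS a) (φ.toPreGNS b)

theorem norm_map_mul_le (φ : M →ₚ[ℂ] ℂ) (x c : M) :
    ‖φ (x * c)‖ ≤ √(φ 1).re * √(φ (star c * c)).re * ‖x‖ := by
  have h := norm_map_star_mul_le φ (star x) c
  rw [star_star] at h
  have h1 : x * star x ≤ (((‖x‖ ^ 2 : ℝ) : ℂ)) • (1 : M) := by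
    have h2 := IsSelfAdjoint.le_algebraMap_norm_self (a := x * star x)
      (IsSelfAdjoint.mul_star_self x)
    rw [CStarRing.norm_self_mul_star, ← sq, Algebra.algebraMap_eq_smul_one] at h2
    simpa only [Complex.coe_smul] using h2
  have h3 := (Complex.le_def.1 (OrderHomClass.mono φ h1)).1
  rw [map_smul, smul_eq_mul, Complex.re_ofReal_mul] at h3
  calc _ ≤ _ := h
    _ ≤ √(‖x‖ ^ 2 * (φ 1).re) * √(φ (star c * c)).re := by gcongr
    _ = _ := by
      rw [Real.sqrt_mul (by positivity), Real.sqrt_sq (norm_nonneg _)]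
      ring

theorem sq_le_self_of_le_one {x : M} (h0 : 0 ≤ x) (h1 : x ≤ 1) : x * x ≤ x := by
  have := CStarAlgebra.pow_antitone h0 h1 (show 1 ≤ 2 by norm_num)
  simpa [sq] using this

/-- If `p ≥ 0` is not zero, then `x ↦ φ(x q)` belongs to the predual for some nonzero piece `q` of
`p`: a maximal `b ≤ p` on which `φ` dominates a vector state `ψ` with
`φ p < ψ p` leaves a piece `q = p - b` below which `φ ≤ ψ`. -/
theorem exists_le_comp_mul_right_mem_predual (φ : M →ₚ[ℂ] ℂ) {p : M}
    (hp : 0 ≤ p) (hp0 : p ≠ 0) :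
    ∃ q : M, 0 ≤ q ∧ q ≤ p ∧ q ≠ 0 ∧ ∃ f ∈ predual M, ∀ x, f x = φ (x * q) := by
  -- a vector `ξ` with `φ p < ⟨ξ, p ξ⟩`
  obtain ⟨ξ, hξ⟩ : ∃ ξ : H, (φ p).re < (⟪ξ, (p : H →L[ℂ] H) ξ⟫_ℂ).re := by
    have : ∃ ζ : H, 0 < (⟪ζ, (p : H →L[ℂ] H) ζ⟫_ℂ).re := by
      by_contra! hcon
      refine hp0 (ext_inner fun ζ => ?_)
      have h1 := Complex.le_def.1 (nonneg_iff_inner.1 hp ζ)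
      have h2 : ⟪ζ, ((0 : M) : H →L[ℂ] H) ζ⟫_ℂ = 0 := by simp
      rw [h2]
      exact Complex.ext (le_antisymm (hcon ζ) h1.1) h1.2.symm
    obtain ⟨ζ, hζ⟩ := this
    obtain ⟨n, hn⟩ := exists_nat_gt ((φ p).re / (⟪ζ, (p : H →L[ℂ] H) ζ⟫_ℂ).re)
    rw [div_lt_iff₀ hζ] at hn
    refine ⟨(((n : ℝ) + 1 : ℝ) : ℂ) • ζ, hn.trans_le ?_⟩
    rw [map_smul, inner_smul_left, inner_smul_right, Complex.conj_ofReal, Complex.re_ofReal_mul,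
      Complex.re_ofReal_mul]
    have hn0 : (0 : ℝ) ≤ n := Nat.cast_nonneg n
    nlinarith [mul_nonneg hn0 hζ.le, mul_nonneg (mul_nonneg hn0 hn0) hζ.le]
  let ψ : M → ℝ := fun x => (⟪ξ, (x : H →L[ℂ] H) ξ⟫_ℂ).re
  have hψadd : ∀ x y, ψ (x + y) = ψ x + ψ y := fun x y => by
    change (vecFunctional M ξ ξ (x + y)).re = _
    rw [map_add]; rfl
  have hψsmul : ∀ (r : ℝ) x, ψ ((r : ℂ) • x) = r * ψ x := fun r x => by
    change (vecFunctional M ξ ξ ((r : ℂ) • x)).re = _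
    rw [map_smul, smul_eq_mul, Complex.re_ofReal_mul]; rfl
  -- a maximal `b ≤ p` with `ψ b ≤ φ b`; on every element below `p - b`, `φ` is then dominated by `ψ`
  obtain ⟨b, -, hb⟩ := zorn_le_nonempty₀ {b : M | 0 ≤ b ∧ b ≤ p ∧ ψ b ≤ (φ b).re} (by
    intro c hc hchain y hy
    have hpos : ∀ d ∈ c, 0 ≤ d := fun d hd => (hc hd).1
    have hdir := hchain.directedOn
    obtain ⟨s, hs, hsψ⟩ := exists_isLUB ⟨y, hy⟩ hdir hpos ⟨p, fun d hd => (hc hd).2.1⟩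
    refine ⟨s, ⟨(hpos y hy).trans (hs.1 hy), hs.2 fun d hd => (hc hd).2.1, ?_⟩, fun z hz => hs.1 hz⟩
    have hmono : ∀ d ∈ c, (φ d).re ≤ (φ s).re := fun d hd =>
      (Complex.le_def.1 (OrderHomClass.mono φ (hs.1 hd))).1
    have h : ⟪ξ, (s : H →L[ℂ] H) ξ⟫_ℂ ≤ ((φ s).re : ℂ) := (hsψ ξ).2 (by
      rintro _ ⟨d, hd, rfl⟩
      have h1 := Complex.le_def.1 (nonneg_iff_inner.1 (hpos d hd) ξ)
      rw [Complex.le_def]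
      exact ⟨((hc hd).2.2).trans (hmono d hd), h1.2.symm⟩)
    exact (Complex.le_def.1 h).1) 0 ⟨le_rfl, hp, by simp [ψ]⟩
  obtain ⟨hb0, hbp, hbψ⟩ := hb.prop
  set q := p - b with hq
  have hq0 : 0 ≤ q := sub_nonneg.2 hbp
  have hqp : q ≤ p := sub_le_self _ hb0
  have hqne : q ≠ 0 := by
    intro h
    rw [hq, sub_eq_zero] at h
    rw [← h] at hbψ
    exact absurd hξ (not_lt.2 hbψ)
  have hdom : ∀ r : M, 0 ≤ r → r ≤ q → (φ r).re ≤ ψ r := by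
    intro r hr hrq
    by_contra! hcon
    have hmem : b + r ∈ {b : M | 0 ≤ b ∧ b ≤ p ∧ ψ b ≤ (φ b).re} := by
      refine ⟨add_nonneg hb0 hr, ?_, ?_⟩
      · rw [hq] at hrq
        exact le_sub_iff_add_le'.1 hrq
      · rw [hψadd, map_add, Complex.add_re]
        exact add_le_add hbψ hcon.le
    have hle := hb.le_of_ge hmem (le_add_of_nonneg_right hr)
    have hr0 : r = 0 := le_antisymm (by simpa using hle) hr
    simp [hr0, ψ] at hcon
  -- the square root of `q` lies in `M`
  let k : M := CFC.sqrt q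
  have hk0 : 0 ≤ k := CFC.sqrt_nonneg q
  have hks : star k = k := hk0.isSelfAdjoint.star_eq
  have hkk : k * k = q := CFC.sqrt_mul_sqrt_self q hq0
  have hbd : ∀ x : M, ‖φ (x * k)‖ ≤ √(φ 1).re * ‖(x : H →L[ℂ] H) ((k : H →L[ℂ] H) ξ)‖ := by
    intro x
    have hr : (φ (star (x * k) * (x * k))).re ≤ ψ (star (x * k) * (x * k)) := by
      rcases eq_or_ne x 0 with rfl | hx
      · simp [ψ]
      have hx' : 0 < ‖x‖ ^ 2 := by positivity
      have hle : star (x * k) * (x * k) ≤ ((‖x‖ ^ 2 : ℝ) : ℂ) • q := by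
        have h2 := IsSelfAdjoint.le_algebraMap_norm_self (a := star x * x)
          (IsSelfAdjoint.star_mul_self x)
        rw [CStarRing.norm_star_mul_self, ← sq, Algebra.algebraMap_eq_smul_one] at h2
        have h3 := star_left_conjugate_le_conjugate h2 k
        rw [hks, mul_smul_comm, smul_mul_assoc, mul_one, hkk, ← Complex.coe_smul] at h3
        rw [star_mul, hks]
        simpa only [mul_assoc] using h3
      have hle' : (((‖x‖ ^ 2)⁻¹ : ℝ) : ℂ) • (star (x * k) * (x * k)) ≤ q := by
        have := smul_le_smul_of_nonneg_left hle
          (show (0 : ℝ) ≤ (‖x‖ ^ 2)⁻¹ by positivity)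
        rw [← Complex.coe_smul, ← Complex.coe_smul (x := (‖x‖ ^ 2)⁻¹), smul_smul,
          ← Complex.ofReal_mul, inv_mul_cancel₀ hx'.ne', Complex.ofReal_one, one_smul] at this
        exact this
      have h4 := hdom _ (by
        rw [Complex.coe_smul]
        exact smul_nonneg (by positivity) (star_mul_self_nonneg _)) hle'
      rw [hψsmul, map_smul, smul_eq_mul, Complex.re_ofReal_mul] at h4
      exact le_of_mul_le_mul_left h4 (by positivity)
    have hψk : ψ (star (x * k) * (x * k)) = ‖(x : H →L[ℂ] H) ((k : H →L[ℂ] H) ξ)‖ ^ 2 := by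
      have h1 : ⟪ξ, ((star (x * k) * (x * k) : M) : H →L[ℂ] H) ξ⟫_ℂ =
          ⟪((x * k : M) : H →L[ℂ] H) ξ, ((x * k : M) : H →L[ℂ] H) ξ⟫_ℂ :=
        ContinuousLinearMap.adjoint_inner_right ((x * k : M) : H →L[ℂ] H) ξ _
      change (⟪ξ, ((star (x * k) * (x * k) : M) : H →L[ℂ] H) ξ⟫_ℂ).re = _
      rw [h1]
      exact inner_self_eq_norm_sq (𝕜 := ℂ) (((x * k : M) : H →L[ℂ] H) ξ)
    have hcs := norm_map_star_mul_le φ 1 (x * k)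
    rw [star_one, one_mul, one_mul] at hcs
    refine hcs.trans ?_
    gcongr
    rw [← Real.sqrt_sq (norm_nonneg ((x : H →L[ℂ] H) ((k : H →L[ℂ] H) ξ))), ← hψk]
    exact Real.sqrt_le_sqrt hr
  obtain ⟨η, hη⟩ := exists_inner_eq_of_norm_le
    (φ.toLinearMap ∘ₗ ((ContinuousLinearMap.mul ℂ M).flip k : M →L[ℂ] M).toLinearMap)
    ({ toFun := fun x : M => (x : H →L[ℂ] H) ((k : H →L[ℂ] H) ξ)
       map_add' := fun _ _ => rfl
       map_smul' := fun _ _ => rfl } : M →ₗ[ℂ] H) _ hbd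
  refine ⟨q, hq0, hqp, hqne, _,
    comp_mul_right_mem_predual k (vecFunctional_mem_predual η ((k : H →L[ℂ] H) ξ)), fun x => ?_⟩
  have := hη (x * k)
  rw [← hkk, ← mul_assoc]
  exact this.symm

/-- Order-normal positive functionals belong to the predual. The elements `b` for which
`x ↦ φ(x b)` is in the predual are closed under suprema by the Cauchy–Schwarz inequality, and a
maximal one in the unit interval has to be `1`, since a nonzero piece of `1 - b` could be added. -/
theorem IsOrderNormal.exists_mem_predual {φ : M →ₚ[ℂ] ℂ} (hφ : IsOrderNormal φ) :
    ∃ f ∈ predual M, ∀ x, f x = φ x := by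
  let φc : M →L[ℂ] ℂ := ⟨φ.toLinearMap, map_continuous φ⟩
  let R : M →L[ℂ] (M →L[ℂ] ℂ) :=
    (ContinuousLinearMap.compL ℂ M M ℂ φc) ∘L (ContinuousLinearMap.mul ℂ M).flip
  have hR : ∀ c x, R c x = φ (x * c) := fun c x => rfl
  have hRn : ∀ c, ‖R c‖ ≤ √(φ 1).re * √(φ (star c * c)).re := fun c =>
    (R c).opNorm_le_bound (by positivity) fun x => norm_map_mul_le φ x c
  -- a maximal `b ≤ 1` for which `x ↦ φ (x b)` lies in the predual; maximality forces `b = 1`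
  obtain ⟨b, -, hb⟩ := zorn_le_nonempty₀ {b : M | 0 ≤ b ∧ b ≤ 1 ∧ R b ∈ predual M} (by
    intro c hc hchain y hy
    have hpos : ∀ d ∈ c, 0 ≤ d := fun d hd => (hc hd).1
    have hdir := hchain.directedOn
    obtain ⟨s, hs, -⟩ := exists_isLUB ⟨y, hy⟩ hdir hpos ⟨1, fun d hd => (hc hd).2.1⟩
    have hs1 : s ≤ 1 := hs.2 fun d hd => (hc hd).2.1
    refine ⟨s, ⟨(hpos y hy).trans (hs.1 hy), hs1, ?_⟩, fun z hz => hs.1 hz⟩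
    have hcl : R s ∈ closure (predual M : Set (M →L[ℂ] ℂ)) := by
      rw [Metric.mem_closure_iff]
      intro ε hε
      obtain ⟨d, hd, hdε⟩ := hφ.exists_re_sub_lt ⟨y, hy⟩ hdir hpos hs
        (show 0 < (ε / (√(φ 1).re + 1)) ^ 2 by positivity)
      refine ⟨R d, (hc hd).2.2, ?_⟩
      have hsd : 0 ≤ s - d := sub_nonneg.2 (hs.1 hd)
      have h1 : star (s - d) * (s - d) ≤ s - d := by
        rw [hsd.isSelfAdjoint.star_eq]
        exact sq_le_self_of_le_one hsd ((sub_le_self _ (hpos d hd)).trans hs1)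
      have h2 := (Complex.le_def.1 (OrderHomClass.mono φ h1)).1
      rw [dist_eq_norm, ← map_sub]
      calc ‖R (s - d)‖ ≤ √(φ 1).re * √(φ (star (s - d) * (s - d))).re := hRn _
        _ ≤ √(φ 1).re * (ε / (√(φ 1).re + 1)) := by
          gcongr
          exact (Real.sqrt_le_sqrt (h2.trans hdε.le)).trans_eq (Real.sqrt_sq (by positivity))
        _ < (√(φ 1).re + 1) * (ε / (√(φ 1).re + 1)) := by
          gcongr
          linarith
        _ = ε := by field_simp
    rwa [isClosed_predual.closure_eq] at hcl) 0 ⟨le_rfl, zero_le_one, by simp⟩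
  obtain ⟨hb0, hb1, hbR⟩ := hb.prop
  have hbeq : b = 1 := by
    by_contra hne
    obtain ⟨q, hq0, hqp, hqne, f, hf, hfq⟩ := exists_le_comp_mul_right_mem_predual φ
      (sub_nonneg.2 hb1) (sub_ne_zero.2 (Ne.symm hne))
    have hRq : R q = f := ContinuousLinearMap.ext fun x => (hfq x).symm
    have hmem : b + q ∈ {b : M | 0 ≤ b ∧ b ≤ 1 ∧ R b ∈ predual M} := by
      refine ⟨add_nonneg hb0 hq0, le_sub_iff_add_le'.1 hqp, ?_⟩
      rw [map_add, hRq]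
      exact add_mem hbR hf
    have hle := hb.le_of_ge hmem (le_add_of_nonneg_right hq0)
    exact hqne (le_antisymm (by simpa using hle) hq0)
  refine ⟨R b, hbR, fun x => ?_⟩
  rw [hR, hbeq, mul_one]

end Predual

end VonNeumannAlgebra

namespace VonNeumannAlgebra

/-! ### Weak* integrals of orbits -/

section WeakStar

variable {H : Type u} [NormedAddCommGroup H] [InnerProductSpace ℂ H] [CompleteSpace H]
  {M : VonNeumannAlgebra H}

theorem exists_mem_predual_eq_predualFunctional (ξ η : lp (fun _ : ℕ => H) 2) :
    ∃ f ∈ predual M, ∀ x, f x = predualFunctional ξ η x := by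
  have hsq : ∀ ζ : lp (fun _ : ℕ => H) 2, Summable fun i => ‖ζ i‖ ^ 2 := fun ζ => by
    have := (memℓp_gen_iff (p := 2) (by norm_num)).1 (lp.memℓp ζ)
    simpa using this
  have hs : Summable fun i => vecFunctional M (ξ i) (η i) := by
    refine Summable.of_norm_bounded ((hsq ξ).add (hsq η)) fun i => ?_
    refine (LinearMap.mkContinuous_norm_le _ (by positivity) _).trans ?_
    nlinarith [sq_nonneg (‖ξ i‖ - ‖η i‖), sq_nonneg ‖ξ i‖, sq_nonneg ‖η i‖]
  refine ⟨∑' i, vecFunctional M (ξ i) (η i), ?_, fun x => ?_⟩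
  · exact isClosed_predual.mem_of_tendsto hs.hasSum (Eventually.of_forall fun s =>
      sum_mem fun i _ => vecFunctional_mem_predual _ _)
  · exact ((hs.hasSum.mapL (ContinuousLinearMap.apply ℂ ℂ x)).tsum_eq).symm

theorem predualFunctional_single (ξ η : H) (x : M) :
    predualFunctional (lp.single 2 0 ξ) (lp.single 2 0 η) x = ⟪ξ, (x : H →L[ℂ] H) η⟫_ℂ := by
  rw [predualFunctional, tsum_eq_single 0]
  · simp
  · intro i hi
    simp [hi]

variable {Ω : Type*} [TopologicalSpace Ω]

theorem continuous_of_mem_predual {f : Ω → M} {C : ℝ} (hf : ∀ s, ‖f s‖ ≤ C)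
    (hc : ∀ ξ η : H, Continuous fun s => ⟪ξ, (f s : H →L[ℂ] H) η⟫_ℂ) {g : M →L[ℂ] ℂ}
    (hg : g ∈ predual M) : Continuous fun s => g (f s) := by
  let W : Submodule ℂ (M →L[ℂ] ℂ) :=
    { carrier := {g | Continuous fun s => g (f s)}
      add_mem' := fun ha hb => Continuous.add ha hb
      zero_mem' := continuous_const
      smul_mem' := fun c _ ha => Continuous.const_smul ha c }
  refine predual_le (W := W) ?_ hc hg
  refine isClosed_of_closure_subset fun g hg => ?_
  refine continuous_of_uniform_approx_of_continuous fun u hu => ?_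
  obtain ⟨ε, hε, hεu⟩ := Metric.mem_uniformity_dist.1 hu
  obtain ⟨g', hg', hd⟩ := Metric.mem_closure_iff.1 hg (ε / (|C| + 1)) (by positivity)
  refine ⟨fun s => g' (f s), hg', fun s => hεu ?_⟩
  rw [dist_eq_norm] at hd ⊢
  calc ‖g (f s) - g' (f s)‖ = ‖(g - g') (f s)‖ := rfl
    _ ≤ ‖g - g'‖ * ‖f s‖ := (g - g').le_opNorm _
    _ ≤ ‖g - g'‖ * (|C| + 1) := by
      gcongr
      exact ((hf s).trans (le_abs_self C)).trans (by linarith)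
    _ < (ε / (|C| + 1)) * (|C| + 1) := by gcongr
    _ = ε := by field_simp

variable [MeasurableSpace Ω] [OpensMeasurableSpace Ω]

theorem integrable_of_mem_predual {f : Ω → M} {C : ℝ} (hf : ∀ s, ‖f s‖ ≤ C)
    (hc : ∀ ξ η : H, Continuous fun s => ⟪ξ, (f s : H →L[ℂ] H) η⟫_ℂ) (μ : Measure Ω)
    [IsFiniteMeasure μ] {g : M →L[ℂ] ℂ} (hg : g ∈ predual M) :
    Integrable (fun s => g (f s)) μ := by
  refine Integrable.of_bound (continuous_of_mem_predual hf hc hg).aestronglyMeasurable (‖g‖ * C)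
    (Eventually.of_forall fun s => (g.le_opNorm _).trans ?_)
  gcongr
  exact hf s

/-- Elements of the predual commute with weak integrals. -/
theorem map_eq_integral_of_mem_predual {f : Ω → M} {C : ℝ} (hf : ∀ s, ‖f s‖ ≤ C)
    (hc : ∀ ξ η : H, Continuous fun s => ⟪ξ, (f s : H →L[ℂ] H) η⟫_ℂ) (μ : Measure Ω)
    [IsFiniteMeasure μ] {y : M}
    (hy : ∀ ξ η : H, ⟪ξ, (y : H →L[ℂ] H) η⟫_ℂ = ∫ s, ⟪ξ, (f s : H →L[ℂ] H) η⟫_ℂ ∂μ)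
    {g : M →L[ℂ] ℂ} (hg : g ∈ predual M) : g y = ∫ s, g (f s) ∂μ := by
  have hi : ∀ {g : M →L[ℂ] ℂ}, g ∈ predual M → Integrable (fun s => g (f s)) μ :=
    fun hg => integrable_of_mem_predual hf hc μ hg
  let W : Submodule ℂ (M →L[ℂ] ℂ) :=
    { carrier := {g | g ∈ predual M ∧ g y = ∫ s, g (f s) ∂μ}
      add_mem' := fun {a b} ha hb => ⟨add_mem ha.1 hb.1, by
        simp only [add_apply, ha.2, hb.2]
        exact (integral_add (hi ha.1) (hi hb.1)).symm⟩
      zero_mem' := ⟨zero_mem _, by simp⟩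
      smul_mem' := fun c a ha => ⟨Submodule.smul_mem _ c ha.1, by
        simp only [smul_apply, ha.2]
        exact (integral_const_mul _ _).symm⟩ }
  refine (predual_le (W := W) ?_ (fun ξ η => ⟨vecFunctional_mem_predual ξ η, hy ξ η⟩) hg).2
  refine isClosed_of_closure_subset fun g hg => ?_
  have hgp : g ∈ predual M :=
    closure_minimal (fun a (ha : a ∈ W) => ha.1) isClosed_predual hg
  refine ⟨hgp, eq_of_forall_dist_le fun ε hε => ?_⟩
  set K : ℝ := ‖y‖ + |C| * μ.real Set.univ + 1
  have hK : 0 < K := by positivity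
  obtain ⟨g', hg', hd⟩ := Metric.mem_closure_iff.1 hg (ε / K) (by positivity)
  rw [dist_eq_norm] at hd ⊢
  have h1 : g y - ∫ s, g (f s) ∂μ = (g - g') y - ∫ s, (g - g') (f s) ∂μ := by
    have : ∫ s, (g - g') (f s) ∂μ = ∫ s, g (f s) ∂μ - ∫ s, g' (f s) ∂μ :=
      integral_sub (hi hgp) (hi hg'.1)
    rw [this, sub_apply, hg'.2]
    ring
  rw [h1]
  have h2 : ‖∫ s, (g - g') (f s) ∂μ‖ ≤ (‖g - g'‖ * |C|) * μ.real Set.univ :=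
    norm_integral_le_of_norm_le_const (Eventually.of_forall fun s =>
      ((g - g').le_opNorm _).trans (by gcongr; exact (hf s).trans (le_abs_self C)))
  calc _ ≤ ‖(g - g') y‖ + ‖∫ s, (g - g') (f s) ∂μ‖ := norm_sub_le _ _
    _ ≤ ‖g - g'‖ * ‖y‖ + (‖g - g'‖ * |C|) * μ.real Set.univ := add_le_add ((g - g').le_opNorm _) h2
    _ ≤ ‖g - g'‖ * K := by
      simp only [K]
      nlinarith [norm_nonneg (g - g')]
    _ ≤ ε / K * K := by gcongr
    _ = ε := by field_simp

theorem isWeakStarIntegral_of_inner {f : Ω → M} {C : ℝ} (hf : ∀ s, ‖f s‖ ≤ C)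
    (hc : ∀ ξ η : H, Continuous fun s => ⟪ξ, (f s : H →L[ℂ] H) η⟫_ℂ) (μ : Measure Ω)
    [IsFiniteMeasure μ] {y : M}
    (hy : ∀ ξ η : H, ⟪ξ, (y : H →L[ℂ] H) η⟫_ℂ = ∫ s, ⟪ξ, (f s : H →L[ℂ] H) η⟫_ℂ ∂μ) :
    IsWeakStarIntegral f μ y := by
  intro ξ η
  obtain ⟨g, hg, hgf⟩ := exists_mem_predual_eq_predualFunctional (M := M) ξ η
  simp only [← hgf]
  exact ⟨integrable_of_mem_predual hf hc μ hg, map_eq_integral_of_mem_predual hf hc μ hy hg⟩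

theorem norm_le_of_inner_le {y : M} {C : ℝ} (hC : 0 ≤ C)
    (h : ∀ ξ η : H, ‖⟪ξ, (y : H →L[ℂ] H) η⟫_ℂ‖ ≤ C * ‖ξ‖ * ‖η‖) : ‖y‖ ≤ C := by
  refine (y : H →L[ℂ] H).opNorm_le_bound hC fun η => ?_
  rcases (norm_nonneg ((y : H →L[ℂ] H) η)).eq_or_lt with h0 | h0
  · rw [← h0]; positivity
  · have := h ((y : H →L[ℂ] H) η) η
    rw [inner_self_eq_norm_sq_to_K, norm_pow, RCLike.norm_ofReal, abs_norm] at this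
    nlinarith

end WeakStar

end VonNeumannAlgebra

open VonNeumannAlgebra

namespace TracePreservingAction

section Average

variable {G : Type v} [Group G] [TopologicalSpace G] {H : Type u}
  [NormedAddCommGroup H] [InnerProductSpace ℂ H] [CompleteSpace H] {M : VonNeumannAlgebra H}
  {τ : SFNTrace M} (α : TracePreservingAction G τ)

theorem norm_map (g : G) (x : M) : ‖α g x‖ = ‖x‖ :=
  (StarAlgEquiv.isometry (α g)).norm_map_of_map_zero (map_zero _) x

theorem map_mul_apply (g h : G) (x : M) : α (g * h) x = α g (α h x) := by
  rw [map_mul]; rfl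

theorem map_one_apply (x : M) : α 1 x = x := by
  rw [map_one]; rfl

theorem map_inv_apply_map (g : G) (x : M) : α g⁻¹ (α g x) = x := by
  rw [← map_mul_apply, inv_mul_cancel, map_one_apply]

theorem map_apply_map_inv (g : G) (x : M) : α g (α g⁻¹ x) = x := by
  rw [← map_mul_apply, mul_inv_cancel, map_one_apply]

theorem map_mono (g : G) {x y : M} (h : x ≤ y) : α g x ≤ α g y := by
  rw [← sub_nonneg, ← map_sub]
  exact α.map_nonneg g (sub_nonneg.2 h)

theorem isLUB_map (g : G) {D : Set M} {x : M} (hx : IsLUB D x) :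
    IsLUB ((fun d => α g d) '' D) (α g x) := by
  constructor
  · rintro _ ⟨d, hd, rfl⟩
    exact α.map_mono g (hx.1 hd)
  · intro y hy
    have : x ≤ α g⁻¹ y := hx.2 fun d hd => by
      rw [← α.map_inv_apply_map g d]
      exact α.map_mono _ (hy ⟨d, hd, rfl⟩)
    rw [← α.map_apply_map_inv g y]
    exact α.map_mono g this

theorem continuous_inner (x : M) (ξ η : H) :
    Continuous fun g => ⟪ξ, (α g x : H →L[ℂ] H) η⟫_ℂ := by
  simpa only [predualFunctional_single] using
    α.continuous' x (lp.single 2 0 ξ) (lp.single 2 0 η)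

/-- Automorphisms of `M` are weak*-continuous: they preserve suprema, so that their compositions
with vector states are order-normal. -/
theorem exists_mem_predual_inner_map (g : G) (ξ : H) :
    ∃ f ∈ predual M, ∀ x, f x = ⟪ξ, (α g x : H →L[ℂ] H) ξ⟫_ℂ := by
  let φ : M →ₚ[ℂ] ℂ := PositiveLinearMap.mk₀
    { toFun := fun x => ⟪ξ, (α g x : H →L[ℂ] H) ξ⟫_ℂ
      map_add' := fun x y => by
        rw [map_add]
        exact inner_add_right ξ ((α g x : H →L[ℂ] H) ξ) ((α g y : H →L[ℂ] H) ξ)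
      map_smul' := fun c x => by
        rw [map_smul]
        exact inner_smul_right ξ ((α g x : H →L[ℂ] H) ξ) c }
    fun x hx => nonneg_iff_inner.1 (α.map_nonneg g hx) ξ
  have hφ : IsOrderNormal φ := by
    intro D x hne hdir hpos hx
    have h := isLUB_inner (hne.image fun d => α g d) (D := (fun d => α g d) '' D)
      (by
        rintro _ ⟨a, ha, rfl⟩ _ ⟨b, hb, rfl⟩
        obtain ⟨e, he, hae, hbe⟩ := hdir a ha b hb
        exact ⟨_, ⟨e, he, rfl⟩, α.map_mono g hae, α.map_mono g hbe⟩)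
      (by
        rintro _ ⟨a, ha, rfl⟩
        exact α.map_nonneg g (hpos a ha)) (α.isLUB_map g hx) ξ
    rw [Set.image_image] at h
    exact h
  exact hφ.exists_mem_predual

variable [MeasurableSpace G] [OpensMeasurableSpace G]

theorem exists_avg (μ : Measure G) [IsFiniteMeasure μ] (x : M) :
    ∃ y : M, ∀ ξ η : H,
      ⟪ξ, (y : H →L[ℂ] H) η⟫_ℂ = ∫ g, ⟪ξ, (α g x : H →L[ℂ] H) η⟫_ℂ ∂μ :=
  exists_inner_eq_integral μ (fun g => α g x) ‖x‖ (fun g => (α.norm_map g x).le)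
    fun ξ η => (α.continuous_inner x ξ η).aestronglyMeasurable

theorem integrable_inner (μ : Measure G) [IsFiniteMeasure μ] (x : M) (ξ η : H) :
    Integrable (fun g => ⟪ξ, (α g x : H →L[ℂ] H) η⟫_ℂ) μ :=
  Integrable.of_bound (α.continuous_inner x ξ η).aestronglyMeasurable (‖x‖ * ‖ξ‖ * ‖η‖)
    (Eventually.of_forall fun g => (norm_inner_apply_le _ ξ η).trans_eq (by rw [α.norm_map]))

/-- The average `x ↦ ∫ α_g(x) dμ(g)` of the action on `M` for a finite measure `μ`, as a weak*
integral. -/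
noncomputable def avg (μ : Measure G) [IsFiniteMeasure μ] : M →ₗ[ℂ] M where
  toFun x := (α.exists_avg μ x).choose
  map_add' x y := ext_inner fun ξ => by
    have h : ∀ a b : M, ⟪ξ, ((a + b : M) : H →L[ℂ] H) ξ⟫_ℂ =
        ⟪ξ, (a : H →L[ℂ] H) ξ⟫_ℂ + ⟪ξ, (b : H →L[ℂ] H) ξ⟫_ℂ := fun a b => inner_add_right _ _ _
    rw [h, (α.exists_avg μ _).choose_spec, (α.exists_avg μ _).choose_spec,
      (α.exists_avg μ _).choose_spec, ← integral_add (α.integrable_inner μ x ξ ξ)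
      (α.integrable_inner μ y ξ ξ)]
    simp only [map_add, h]
  map_smul' c x := ext_inner fun ξ => by
    have h : ∀ a : M, ⟪ξ, ((c • a : M) : H →L[ℂ] H) ξ⟫_ℂ = c * ⟪ξ, (a : H →L[ℂ] H) ξ⟫_ℂ :=
      fun a => inner_smul_right _ _ _
    rw [RingHom.id_apply, h, (α.exists_avg μ _).choose_spec, (α.exists_avg μ _).choose_spec,
      ← integral_const_mul]
    simp only [map_smul, h]

theorem inner_avg (μ : Measure G) [IsFiniteMeasure μ] (x : M) (ξ η : H) :
    ⟪ξ, (α.avg μ x : H →L[ℂ] H) η⟫_ℂ = ∫ g, ⟪ξ, (α g x : H →L[ℂ] H) η⟫_ℂ ∂μ :=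
  (α.exists_avg μ x).choose_spec ξ η

theorem map_avg_of_mem_predual (μ : Measure G) [IsFiniteMeasure μ] (x : M) {f : M →L[ℂ] ℂ}
    (hf : f ∈ predual M) : f (α.avg μ x) = ∫ g, f (α g x) ∂μ :=
  map_eq_integral_of_mem_predual (fun g => (α.norm_map g x).le) (α.continuous_inner x) μ
    (α.inner_avg μ x) hf

theorem isWeakStarIntegral_avg (μ : Measure G) [IsFiniteMeasure μ] (x : M) :
    IsWeakStarIntegral (fun g => α g x) μ (α.avg μ x) :=
  isWeakStarIntegral_of_inner (fun g => (α.norm_map g x).le) (α.continuous_inner x) μ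
    (α.inner_avg μ x)

theorem norm_avg_le (μ : Measure G) [IsFiniteMeasure μ] (x : M) :
    ‖α.avg μ x‖ ≤ μ.real Set.univ * ‖x‖ := by
  refine norm_le_of_inner_le (by positivity) fun ξ η => ?_
  rw [inner_avg]
  calc _ ≤ (‖x‖ * ‖ξ‖ * ‖η‖) * μ.real Set.univ :=
        norm_integral_le_of_norm_le_const (Eventually.of_forall fun g =>
          (norm_inner_apply_le _ ξ η).trans_eq (by rw [α.norm_map]))
    _ = _ := by ring

theorem avg_nonneg (μ : Measure G) [IsFiniteMeasure μ] {x : M} (hx : 0 ≤ x) :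
    0 ≤ α.avg μ x := by
  rw [nonneg_iff_inner]
  intro ξ
  rw [inner_avg]
  have h : ∀ g, ⟪ξ, (α g x : H →L[ℂ] H) ξ⟫_ℂ = ((⟪ξ, (α g x : H →L[ℂ] H) ξ⟫_ℂ).re : ℂ) := fun g =>
    Complex.ext rfl (Complex.le_def.1 (nonneg_iff_inner.1 (α.map_nonneg g hx) ξ)).2.symm
  rw [integral_congr_ae (Eventually.of_forall h), integral_complex_ofReal, Complex.zero_le_real]
  exact integral_nonneg fun g => (Complex.le_def.1 (nonneg_iff_inner.1 (α.map_nonneg g hx) ξ)).1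

theorem avg_add_measure (μ ν : Measure G) [IsFiniteMeasure μ] [IsFiniteMeasure ν] (x : M) :
    α.avg (μ + ν) x = α.avg μ x + α.avg ν x := by
  refine ext_inner fun ξ => ?_
  have h : ⟪ξ, ((α.avg μ x + α.avg ν x : M) : H →L[ℂ] H) ξ⟫_ℂ =
    ⟪ξ, (α.avg μ x : H →L[ℂ] H) ξ⟫_ℂ + ⟪ξ, (α.avg ν x : H →L[ℂ] H) ξ⟫_ℂ := inner_add_right _ _ _
  rw [h, inner_avg, inner_avg, inner_avg,
    integral_add_measure (α.integrable_inner μ x ξ ξ) (α.integrable_inner ν x ξ ξ)]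

theorem avg_smul_measure (c : ℝ≥0) (μ : Measure G) [IsFiniteMeasure μ] (x : M) :
    α.avg (c • μ) x = (c : ℝ) • α.avg μ x := by
  refine ext_inner fun ξ => ?_
  have h : ⟪ξ, (((c : ℝ) • α.avg μ x : M) : H →L[ℂ] H) ξ⟫_ℂ =
    ((c : ℝ) : ℂ) * ⟪ξ, (α.avg μ x : H →L[ℂ] H) ξ⟫_ℂ := inner_smul_right _ _ _
  rw [h, inner_avg, inner_avg, integral_smul_nnreal_measure]
  rfl

theorem avg_zero_measure (x : M) : α.avg (0 : Measure G) x = 0 := by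
  refine ext_inner fun ξ => ?_
  rw [inner_avg]
  simp

theorem avg_mono_measure {μ ν : Measure G} [IsFiniteMeasure μ] [IsFiniteMeasure ν] (h : μ ≤ ν)
    {x : M} (hx : 0 ≤ x) : α.avg μ x ≤ α.avg ν x := by
  have h1 : α.avg (ν - μ + μ) x = α.avg ν x := by
    refine ext_inner fun ξ => ?_
    rw [inner_avg, inner_avg, Measure.sub_add_cancel_of_le h]
  rw [← h1, avg_add_measure]
  exact le_add_of_nonneg_left (α.avg_nonneg _ hx)

theorem avg_dirac_one (x : M) : α.avg (Measure.dirac (1 : G)) x = x := by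
  refine ext_inner fun ξ => ?_
  rw [inner_avg, integral_dirac' _ _ (α.continuous_inner x ξ ξ).stronglyMeasurable, map_one_apply]

theorem avg_sum_measure (μ : ℕ → Measure G) [∀ j, IsFiniteMeasure (μ j)] (n : ℕ) (x : M) :
    α.avg (∑ j ∈ Finset.range n, μ j) x = ∑ j ∈ Finset.range n, α.avg (μ j) x := by
  induction n with
  | zero => exact α.avg_zero_measure x
  | succ n ih =>
    rw [Finset.sum_range_succ (fun j => α.avg (μ j) x), ← ih, ← avg_add_measure]
    exact VonNeumannAlgebra.ext_inner fun ξ => by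
      rw [inner_avg, inner_avg, Finset.sum_range_succ]

end Average

section Convolution

variable {G : Type v} [Group G] [TopologicalSpace G] [IsTopologicalGroup G]
  [SecondCountableTopology G] [MeasurableSpace G] [BorelSpace G] {H : Type u}
  [NormedAddCommGroup H] [InnerProductSpace ℂ H] [CompleteSpace H] {M : VonNeumannAlgebra H}
  {τ : SFNTrace M} (α : TracePreservingAction G τ)

/-- Averages compose by convolution. This is where weak*-continuity of the automorphisms `α_g` is
used, to move `α_g` under the integral that defines `avg ν`. -/
theorem avg_mconv (μ ν : Measure G) [IsFiniteMeasure μ] [IsFiniteMeasure ν] (x : M) :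
    α.avg (μ.mconv ν) x = α.avg μ (α.avg ν x) := by
  refine ext_inner fun ξ => ?_
  rw [inner_avg, inner_avg, integral_mconv (α.integrable_inner _ x ξ ξ)]
  refine integral_congr_ae (Eventually.of_forall fun g => ?_)
  obtain ⟨f, hf, hfg⟩ := α.exists_mem_predual_inner_map g ξ
  have := α.map_avg_of_mem_predual ν x hf
  simp only [hfg, ← map_mul_apply] at this
  exact this.symm

end Convolution

end TracePreservingAction

namespace SFNTrace

/-! ### Inequalities for traces -/

section Trace

open VonNeumannAlgebra

variable {H : Type u} [NormedAddCommGroup H] [InnerProductSpace ℂ H] [CompleteSpace H]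
  {M : VonNeumannAlgebra H} (τ : SFNTrace M)

theorem map_zero : τ 0 = 0 := by
  have := τ.map_smul' 0 0 le_rfl
  simpa using this

theorem mono {x y : M} (hx : 0 ≤ x) (h : x ≤ y) : τ x ≤ τ y := by
  have := τ.map_add' x (y - x) hx (sub_nonneg.2 h)
  rw [add_sub_cancel] at this
  rw [this]
  exact le_self_add

theorem map_smul_nnreal (r : ℝ≥0) {x : M} (hx : 0 ≤ x) : τ ((r : ℝ) • x) = r * τ x := by
  rw [← Complex.coe_smul]
  exact τ.map_smul' r x hx

theorem map_smul_real {r : ℝ} (hr : 0 ≤ r) {x : M} (hx : 0 ≤ x) :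
    τ (r • x) = ENNReal.ofReal r * τ x := by
  lift r to ℝ≥0 using hr
  rw [map_smul_nnreal τ r hx, ENNReal.ofReal_coe_nnreal]

theorem star_mul_self_le (c : M) : star c * c ≤ (‖c‖ ^ 2) • (1 : M) := by
  rw [← Algebra.algebraMap_eq_smul_one]
  exact CStarAlgebra.star_mul_le_algebraMap_norm_sq

theorem conjugate_nonneg {z : M} (hz : 0 ≤ z) (c : M) : 0 ≤ star c * z * c :=
  star_left_conjugate_nonneg hz c

theorem map_conjugate_eq {z : M} (hz : 0 ≤ z) (c : M) :
    τ (star c * z * c) = τ (CFC.sqrt z * (c * star c) * CFC.sqrt z) := by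
  have hs : star (CFC.sqrt z) = CFC.sqrt z := (CFC.sqrt_nonneg z).isSelfAdjoint.star_eq
  have h := τ.map_star_mul_self' (CFC.sqrt z * c)
  rw [star_mul, hs] at h
  calc τ (star c * z * c) = τ (star c * CFC.sqrt z * (CFC.sqrt z * c)) := by
        congr 1
        rw [mul_assoc (star c) (CFC.sqrt z), ← mul_assoc (CFC.sqrt z), CFC.sqrt_mul_sqrt_self z hz,
          mul_assoc]
    _ = _ := by
        rw [h]
        congr 1

theorem map_conjugate_le {z : M} (hz : 0 ≤ z) {c : M} (hc : ‖c‖ ≤ 1) :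
    τ (star c * z * c) ≤ τ z := by
  have hs : star (CFC.sqrt z) = CFC.sqrt z := (CFC.sqrt_nonneg z).isSelfAdjoint.star_eq
  rw [map_conjugate_eq τ hz]
  have h1 : c * star c ≤ 1 := by
    refine (star_mul_self_le (star c)).trans' (by rw [star_star]) |>.trans ?_
    rw [norm_star]
    calc (‖c‖ ^ 2) • (1 : M) ≤ (1 : ℝ) • (1 : M) :=
          smul_le_smul_of_nonneg_right (by nlinarith [norm_nonneg c]) zero_le_one
      _ = 1 := one_smul _ _
  have h2 := star_left_conjugate_le_conjugate h1 (CFC.sqrt z)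
  have h3 := star_left_conjugate_nonneg (mul_star_self_nonneg c) (CFC.sqrt z)
  rw [hs] at h2 h3
  rw [mul_one, CFC.sqrt_mul_sqrt_self z hz] at h2
  exact τ.mono h3 h2

theorem map_conjugate_lt_top {z : M} (hz : 0 ≤ z) {c : M} (hc : τ (star c * c) < ∞) :
    τ (star c * z * c) < ∞ := by
  have h1 : star c * z * c ≤ ‖z‖ • (star c * c) :=
    CStarAlgebra.star_left_conjugate_le_norm_smul hz.isSelfAdjoint
  refine (τ.mono (conjugate_nonneg hz c) h1).trans_lt ?_
  rw [map_smul_real τ (norm_nonneg z) (star_mul_self_nonneg c)]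
  exact ENNReal.mul_lt_top ENNReal.ofReal_lt_top hc

/-- The piecewise linear function that is `0` on the negative half-line, `1` beyond `1 / (n + 1)`
and linear in between. -/
noncomputable def cutoff (n : ℕ) (t : ℝ) : ℝ := min 1 (max 0 ((n + 1) * t))

theorem continuous_cutoff (n : ℕ) : Continuous (cutoff n) := by
  unfold cutoff
  fun_prop

theorem cutoff_nonneg (n : ℕ) (t : ℝ) : 0 ≤ cutoff n t :=
  le_min zero_le_one (le_max_left _ _)

theorem cutoff_le_one (n : ℕ) (t : ℝ) : cutoff n t ≤ 1 := min_le_left _ _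

theorem cutoff_of_nonpos (n : ℕ) {t : ℝ} (ht : t ≤ 0) : cutoff n t = 0 := by
  have : ((n : ℝ) + 1) * t ≤ 0 := mul_nonpos_of_nonneg_of_nonpos (by positivity) ht
  simp [cutoff, this]

theorem cutoff_mono {m n : ℕ} (h : m ≤ n) (t : ℝ) : cutoff m t ≤ cutoff n t := by
  rcases le_total t 0 with ht | ht
  · rw [cutoff_of_nonpos m ht, cutoff_of_nonpos n ht]
  · unfold cutoff
    gcongr

theorem abs_cutoff_sub_le (n : ℕ) (t : ℝ) :
    |cutoff n t * t * cutoff n t - t⁺| ≤ 1 / ((n : ℝ) + 1) := by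
  have hn : (0 : ℝ) < n + 1 := by positivity
  rcases le_total t 0 with ht | ht
  · rw [cutoff_of_nonpos n ht, posPart_eq_zero.2 ht]
    simp only [mul_zero, sub_zero, abs_zero]
    positivity
  · rw [posPart_eq_self.2 ht]
    have h0 := cutoff_nonneg n t
    have h1 := cutoff_le_one n t
    rw [abs_sub_comm, abs_of_nonneg (by nlinarith [mul_nonneg h0 ht])]
    rcases le_total ((n + 1) * t) 1 with h | h
    · have : t ≤ 1 / ((n : ℝ) + 1) := by
        rw [le_div_iff₀ hn]
        linarith
      nlinarith [mul_nonneg (mul_nonneg h0 ht) h0]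
    · have : cutoff n t = 1 := by
        unfold cutoff
        exact min_eq_left (h.trans (le_max_right _ _))
      rw [this]
      simp only [one_mul, mul_one, sub_self]
      positivity

theorem isSelfAdjoint_cfc_cutoff (n : ℕ) (y : M) : IsSelfAdjoint (cfc (cutoff n) y) :=
  cfc_predicate _ _

theorem norm_cfc_cutoff_le (n : ℕ) (y : M) : ‖cfc (cutoff n) y‖ ≤ 1 :=
  norm_cfc_le zero_le_one fun t _ => by
    rw [Real.norm_of_nonneg (cutoff_nonneg n t)]
    exact cutoff_le_one n t

theorem cfc_cutoff_conjugate (n : ℕ) {y : M} (hy : IsSelfAdjoint y) :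
    cfc (cutoff n) y * y * cfc (cutoff n) y =
      cfc (fun t => cutoff n t * t * cutoff n t) y := by
  have hc := (continuous_cutoff n).continuousOn (s := spectrum ℝ y)
  rw [cfc_mul (fun t => cutoff n t * t) (cutoff n) y (hc.mul continuousOn_id) hc,
    cfc_mul (cutoff n) (fun t => t) y hc continuousOn_id, cfc_id' ℝ y]

/-- By normality, the trace of the positive part is determined by its compressions by cutoffs. -/
theorem map_posPart_le {y : M} (hy : IsSelfAdjoint y) {r : ℝ≥0∞}
    (h : ∀ n, τ (cfc (cutoff n) y * y * cfc (cutoff n) y) ≤ r) : τ (y⁺) ≤ r := by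
  have hc : ∀ n, Continuous fun t => cutoff n t * t * cutoff n t := fun n =>
    ((continuous_cutoff n).mul continuous_id).mul (continuous_cutoff n)
  let f : ℕ → M := fun n => cfc (fun t => cutoff n t * t * cutoff n t) y
  have hpos : y⁺ = cfc (fun t : ℝ => t⁺) y := by
    rw [CFC.posPart_def, cfcₙ_eq_cfc]
  have hf0 : ∀ n, 0 ≤ f n := fun n => cfc_nonneg fun t _ => by
    rcases le_total t 0 with ht | ht
    · simp [cutoff_of_nonpos n ht]
    · exact mul_nonneg (mul_nonneg (cutoff_nonneg n t) ht) (cutoff_nonneg n t)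
  have hmono : Monotone f := fun m n hmn => by
    refine cfc_mono (fun t _ => ?_) (hc m).continuousOn (hc n).continuousOn
    rcases le_total t 0 with ht | ht
    · simp [cutoff_of_nonpos _ ht]
    · have h1 := cutoff_mono hmn t
      have h0 := cutoff_nonneg m t
      have h0' := cutoff_nonneg n t
      gcongr
  have htend : Tendsto f atTop (𝓝 (y⁺)) := by
    rw [tendsto_iff_norm_sub_tendsto_zero]
    refine squeeze_zero (fun n => norm_nonneg _) (fun n => ?_)
      tendsto_one_div_add_atTop_nhds_zero_nat
    have hsub : f n - y⁺ = cfc (fun t => cutoff n t * t * cutoff n t - t⁺) y := by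
      rw [hpos, cfc_sub (fun t => cutoff n t * t * cutoff n t) (fun t : ℝ => t⁺) y
        (hc n).continuousOn (continuous_posPart.continuousOn)]
    rw [hsub]
    exact norm_cfc_le (by positivity) fun t _ => abs_cutoff_sub_le n t
  rw [τ.normal' (Set.range f) (y⁺) (Set.range_nonempty f)
    (by
      rintro _ ⟨m, rfl⟩ _ ⟨n, rfl⟩
      exact ⟨f (max m n), ⟨_, rfl⟩, hmono (le_max_left _ _), hmono (le_max_right _ _)⟩)
    (by rintro _ ⟨n, rfl⟩; exact hf0 n) (isLUB_of_tendsto_atTop hmono htend)]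
  refine iSup₂_le ?_
  rintro _ ⟨n, rfl⟩
  have := h n
  rwa [cfc_cutoff_conjugate n hy] at this

theorem cfc_cutoff_conjugate_nonneg (n : ℕ) {y : M} (hy : IsSelfAdjoint y) :
    0 ≤ cfc (cutoff n) y * y * cfc (cutoff n) y := by
  rw [cfc_cutoff_conjugate n hy]
  exact cfc_nonneg fun t _ => by
    rcases le_total t 0 with ht | ht
    · simp [cutoff_of_nonpos n ht]
    · exact mul_nonneg (mul_nonneg (cutoff_nonneg n t) ht) (cutoff_nonneg n t)

/-- The trace of the positive part of `y` is at most that of any positive `a ≥ y`, although `y⁺`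
itself need not be below `a`. -/
theorem map_posPart_le_of_le {y a : M} (hy : IsSelfAdjoint y) (ha : 0 ≤ a) (h : y ≤ a) :
    τ (y⁺) ≤ τ a := by
  refine τ.map_posPart_le hy fun n => ?_
  have hs := (isSelfAdjoint_cfc_cutoff n y).star_eq
  have h1 := star_left_conjugate_le_conjugate h (cfc (cutoff n) y)
  have h2 := τ.map_conjugate_le ha (norm_cfc_cutoff_le n y)
  rw [hs] at h1 h2
  exact (τ.mono (cfc_cutoff_conjugate_nonneg n hy) h1).trans h2

/-- By normality and semifiniteness, the trace of a positive element is the supremum of the traces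
of its compressions by contractions of finite trace. -/
theorem map_le_of_conjugate_le {z : M} (hz : 0 ≤ z) {r : ℝ≥0∞}
    (h : ∀ c : M, IsSelfAdjoint c → ‖c‖ ≤ 1 → τ (c * c) < ∞ → τ (c * z * c) ≤ r) : τ z ≤ r := by
  rcases eq_or_ne r ∞ with rfl | hr
  · exact le_top
  -- below `z`, elements of finite trace are handled by compressing with cutoffs of themselves,
  -- which have finite trace as well
  have hfin : ∀ y : M, 0 ≤ y → y ≤ z → τ y < ∞ → τ y ≤ r := by
    intro y hy hyz hτ
    rw [← (CFC.posPart_eq_self y).2 hy]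
    refine τ.map_posPart_le hy.isSelfAdjoint fun n => ?_
    have hs := (isSelfAdjoint_cfc_cutoff n y).star_eq
    have h1 := star_left_conjugate_le_conjugate hyz (cfc (cutoff n) y)
    rw [hs] at h1
    refine (τ.mono (cfc_cutoff_conjugate_nonneg n hy.isSelfAdjoint) h1).trans
      (h _ (isSelfAdjoint_cfc_cutoff n y) (norm_cfc_cutoff_le n y) ?_)
    have hc := (continuous_cutoff n).continuousOn (s := spectrum ℝ y)
    have h2 : cfc (cutoff n) y * cfc (cutoff n) y ≤ ((n : ℝ) + 1) • y := by
      rw [← cfc_mul (cutoff n) (cutoff n) y hc hc, ← cfc_const_mul_id ((n : ℝ) + 1) y]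
      refine cfc_mono (fun t ht => ?_) (hc.mul hc) (by fun_prop)
      have ht0 : 0 ≤ t := spectrum_nonneg_of_nonneg hy ht
      have hle : cutoff n t ≤ (n + 1) * t :=
        (min_le_right _ _).trans (max_le (by positivity) le_rfl)
      nlinarith [cutoff_nonneg n t, cutoff_le_one n t]
    have h3 : 0 ≤ cfc (cutoff n) y * cfc (cutoff n) y := by
      have := star_mul_self_nonneg (cfc (cutoff n) y)
      rwa [hs] at this
    refine (τ.mono h3 h2).trans_lt ?_
    rw [map_smul_real τ (by positivity) hy]
    exact ENNReal.mul_lt_top ENNReal.ofReal_lt_top hτ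
  -- by semifiniteness, a maximal `b ≤ z` with `τ b ≤ r` is `z` itself
  obtain ⟨b, -, hb⟩ := zorn_le_nonempty₀ {b : M | 0 ≤ b ∧ b ≤ z ∧ τ b ≤ r} (by
    intro c hc hchain y hy
    have hpos : ∀ d ∈ c, 0 ≤ d := fun d hd => (hc hd).1
    have hdir := hchain.directedOn
    obtain ⟨s, hs, -⟩ := exists_isLUB ⟨y, hy⟩ hdir hpos ⟨z, fun d hd => (hc hd).2.1⟩
    refine ⟨s, ⟨(hpos y hy).trans (hs.1 hy), hs.2 fun d hd => (hc hd).2.1, ?_⟩,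
      fun z hz => hs.1 hz⟩
    rw [τ.normal' c s ⟨y, hy⟩ hdir hpos hs]
    exact iSup₂_le fun d hd => (hc hd).2.2) 0 ⟨le_rfl, hz, by rw [map_zero]; exact zero_le⟩
  obtain ⟨hb0, hbz, hbr⟩ := hb.prop
  have hbeq : b = z := by
    by_contra hne
    obtain ⟨w, hw0, hwz, hwne, hwτ⟩ := τ.semifinite' (z - b) (sub_nonneg.2 hbz)
      (sub_ne_zero.2 (Ne.symm hne))
    have hle : b + w ≤ z := le_sub_iff_add_le'.1 hwz
    have hτ : τ (b + w) < ∞ := by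
      rw [τ.map_add' b w hb0 hw0]
      exact ENNReal.add_lt_top.2 ⟨hbr.trans_lt hr.lt_top, hwτ⟩
    have := hb.le_of_ge ⟨add_nonneg hb0 hw0, hle, hfin _ (add_nonneg hb0 hw0) hle hτ⟩
      (le_add_of_nonneg_right hw0)
    exact hwne (le_antisymm (by simpa using this) hw0)
  rwa [← hbeq]

/-- An additive, positively homogeneous and nonnegative function on the positive cone extends to a
positive linear functional. -/
theorem exists_positiveLinearMap (w : M → ℝ) (hw0 : ∀ x, 0 ≤ x → 0 ≤ w x)
    (hadd : ∀ x y, 0 ≤ x → 0 ≤ y → w (x + y) = w x + w y)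
    (hsmul : ∀ (r : ℝ) (x : M), 0 ≤ r → 0 ≤ x → w (r • x) = r * w x) :
    ∃ φ : M →ₚ[ℂ] ℂ, ∀ x, 0 ≤ x → φ x = w x := by
  -- `v` is the real-linear extension of `w` to self-adjoint elements
  let v : M → ℝ := fun a => w (a⁺) - w (a⁻)
  have hv : ∀ a p q : M, IsSelfAdjoint a → 0 ≤ p → 0 ≤ q → a = p - q → v a = w p - w q := by
    intro a p q ha hp hq h
    have h1 := CFC.posPart_sub_negPart a ha
    have h2 : a⁺ + q = p + a⁻ := by
      rw [← sub_eq_sub_iff_add_eq_add, h1, h]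
    have h3 := congrArg w h2
    rw [hadd _ _ (CFC.posPart_nonneg a) hq, hadd _ _ hp (CFC.negPart_nonneg a)] at h3
    simp only [v]
    linarith
  have hvadd : ∀ a b : M, IsSelfAdjoint a → IsSelfAdjoint b → v (a + b) = v a + v b := by
    intro a b ha hb
    rw [hv (a + b) (a⁺ + b⁺) (a⁻ + b⁻) (ha.add hb)
      (add_nonneg (CFC.posPart_nonneg a) (CFC.posPart_nonneg b))
      (add_nonneg (CFC.negPart_nonneg a) (CFC.negPart_nonneg b))
      (by
        rw [add_sub_add_comm, CFC.posPart_sub_negPart a ha, CFC.posPart_sub_negPart b hb]),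
      hadd _ _ (CFC.posPart_nonneg a) (CFC.posPart_nonneg b),
      hadd _ _ (CFC.negPart_nonneg a) (CFC.negPart_nonneg b)]
    simp only [v]
    ring
  have hvsmul : ∀ (r : ℝ) (a : M), IsSelfAdjoint a → v (r • a) = r * v a := by
    intro r a ha
    have hra : IsSelfAdjoint (r • a) := (IsSelfAdjoint.all r).smul ha
    rcases le_total 0 r with hr | hr
    · rw [hv (r • a) (r • a⁺) (r • a⁻) hra (smul_nonneg hr (CFC.posPart_nonneg a))
        (smul_nonneg hr (CFC.negPart_nonneg a))
        (by rw [← smul_sub, CFC.posPart_sub_negPart a ha]),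
        hsmul _ _ hr (CFC.posPart_nonneg a), hsmul _ _ hr (CFC.negPart_nonneg a)]
      simp only [v]
      ring
    · have hr' : 0 ≤ -r := neg_nonneg.2 hr
      rw [hv (r • a) ((-r) • a⁻) ((-r) • a⁺) hra (smul_nonneg hr' (CFC.negPart_nonneg a))
        (smul_nonneg hr' (CFC.posPart_nonneg a))
        (by
          rw [← smul_sub, ← neg_sub, smul_neg, neg_smul, neg_neg,
            CFC.posPart_sub_negPart a ha]),
        hsmul _ _ hr' (CFC.posPart_nonneg a), hsmul _ _ hr' (CFC.negPart_nonneg a)]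
      simp only [v]
      ring
  let f : M →ₗ[ℝ] ℝ :=
    { toFun := fun x => v (realPart x : M)
      map_add' := fun x y => by
        rw [_root_.map_add, AddSubgroup.coe_add]
        exact hvadd _ _ (realPart x).2 (realPart y).2
      map_smul' := fun r x => by
        rw [_root_.map_smul, selfAdjoint.val_smul]
        exact hvsmul r _ (realPart x).2 }
  have hw00 : w 0 = 0 := by simpa using hsmul 0 0 le_rfl le_rfl
  have hf : ∀ x, 0 ≤ x → f x = w x := by
    intro x hx
    change v (realPart x : M) = w x
    rw [hx.isSelfAdjoint.coe_realPart, hv x x 0 hx.isSelfAdjoint hx le_rfl (sub_zero x).symm,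
      hw00, sub_zero]
  have hfI : ∀ x, 0 ≤ x → f (Complex.I • x) = 0 := by
    intro x hx
    change v (realPart (Complex.I • x) : M) = 0
    rw [realPart_I_smul, hx.isSelfAdjoint.imaginaryPart, neg_zero, ZeroMemClass.coe_zero,
      hv 0 0 0 (IsSelfAdjoint.zero M) le_rfl le_rfl (sub_zero 0).symm, sub_self]
  have hφ : ∀ x, 0 ≤ x → (Module.Dual.extendRCLike f : M →ₗ[ℂ] ℂ) x = w x := by
    intro x hx
    rw [Module.Dual.extendRCLike_apply, hf x hx]
    have : f ((RCLike.I : ℂ) • x) = 0 := hfI x hx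
    rw [this]
    simp
  refine ⟨PositiveLinearMap.mk₀ (Module.Dual.extendRCLike f : M →ₗ[ℂ] ℂ) fun x hx => ?_, hφ⟩
  rw [hφ x hx]
  exact Complex.zero_le_real.2 (hw0 x hx)

/-- Compressing the trace by an element of finite trace gives a functional in the predual. -/
theorem exists_mem_predual_conjugate {c : M} (hc : IsSelfAdjoint c) (hτ : τ (c * c) < ∞) :
    ∃ f ∈ predual M, ∀ z, 0 ≤ z → f z = ((τ (c * z * c)).toReal : ℂ) := by
  have hcs := hc.star_eq
  have hpos : ∀ z : M, 0 ≤ z → 0 ≤ c * z * c := fun z hz => by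
    have := conjugate_nonneg hz c
    rwa [hcs] at this
  have hfin : ∀ z : M, 0 ≤ z → τ (c * z * c) < ∞ := fun z hz => by
    have := τ.map_conjugate_lt_top hz (c := c)
    rw [hcs] at this
    exact this hτ
  obtain ⟨φ, hφ⟩ := exists_positiveLinearMap (M := M) (fun z => (τ (c * z * c)).toReal)
    (fun z _ => ENNReal.toReal_nonneg)
    (fun x y hx hy => by
      simp only [mul_add, add_mul]
      rw [τ.map_add' _ _ (hpos x hx) (hpos y hy),
        ENNReal.toReal_add (hfin x hx).ne (hfin y hy).ne])
    (fun r x hr hx => by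
      simp only [mul_smul_comm, smul_mul_assoc]
      rw [τ.map_smul_real hr (hpos x hx), ENNReal.toReal_mul, ENNReal.toReal_ofReal hr])
  have hn : IsOrderNormal φ := by
    intro D x hne hdir hD hx
    have hx0 : 0 ≤ x := by
      obtain ⟨d, hd⟩ := hne
      exact (hD d hd).trans (hx.1 hd)
    have h1 := isLUB_conjugate hne hdir hD hx c
    have h2 := τ.normal' _ _ (hne.image _) (directedOn_conjugate hdir c)
      (by rintro _ ⟨d, hd, rfl⟩; exact conjugate_nonneg (hD d hd) c) h1
    rw [hcs] at h2
    rw [hφ x hx0]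
    constructor
    · rintro _ ⟨d, hd, rfl⟩
      rw [← hφ x hx0]
      exact OrderHomClass.mono φ (hx.1 hd)
    · intro b hb
      have hb' : ∀ d ∈ D, (τ (c * d * c)).toReal ≤ b.re ∧ b.im = 0 := fun d hd => by
        have := hb ⟨d, hd, rfl⟩
        rw [hφ d (hD d hd), Complex.le_def] at this
        exact ⟨this.1, this.2.symm⟩
      obtain ⟨d₀, hd₀⟩ := hne
      have hb0 : 0 ≤ b.re := ENNReal.toReal_nonneg.trans (hb' d₀ hd₀).1
      rw [Complex.le_def]
      refine ⟨?_, (hb' d₀ hd₀).2.symm⟩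
      rw [Complex.ofReal_re]
      refine ENNReal.toReal_le_of_le_ofReal hb0 ?_
      rw [h2]
      refine iSup₂_le ?_
      rintro _ ⟨d, hd, rfl⟩
      rw [← ENNReal.ofReal_toReal (hfin d (hD d hd)).ne]
      exact ENNReal.ofReal_le_ofReal (hb' d hd).1
  obtain ⟨f, hf, hfφ⟩ := hn.exists_mem_predual
  exact ⟨f, hf, fun z hz => by rw [hfφ, hφ z hz]⟩

end Trace

end SFNTrace

namespace TracePreservingAction

section TraceAverage

open SFNTrace

variable {G : Type v} [Group G] [TopologicalSpace G] {H : Type u}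
  [NormedAddCommGroup H] [InnerProductSpace ℂ H] [CompleteSpace H] {M : VonNeumannAlgebra H}
  {τ : SFNTrace M} (α : TracePreservingAction G τ) [MeasurableSpace G] [OpensMeasurableSpace G]

theorem trace_avg_le (μ : Measure G) [IsProbabilityMeasure μ] {x : M} (hx : 0 ≤ x) :
    τ (α.avg μ x) ≤ τ x := by
  rcases eq_or_ne (τ x) ∞ with hτ | hτ
  · rw [hτ]; exact le_top
  refine τ.map_le_of_conjugate_le (α.avg_nonneg μ hx) fun c hc hc1 hcτ => ?_
  obtain ⟨f, hf, hfz⟩ := τ.exists_mem_predual_conjugate hc hcτ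
  have hfin : τ (c * α.avg μ x * c) < ∞ := by
    have := τ.map_conjugate_lt_top (α.avg_nonneg μ hx) (c := c)
    rw [hc.star_eq] at this
    exact this hcτ
  have h1 : ‖f (α.avg μ x)‖ ≤ (τ x).toReal * μ.real Set.univ := by
    rw [α.map_avg_of_mem_predual μ x hf]
    refine norm_integral_le_of_norm_le_const (Eventually.of_forall fun g => ?_)
    rw [hfz _ (α.map_nonneg g hx), Complex.norm_of_nonneg ENNReal.toReal_nonneg]
    refine ENNReal.toReal_mono hτ ?_
    have := τ.map_conjugate_le (α.map_nonneg g hx) hc1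
    rwa [hc.star_eq, α.trace_map' g x hx] at this
  rw [hfz _ (α.avg_nonneg μ hx), Complex.norm_of_nonneg ENNReal.toReal_nonneg, probReal_univ,
    mul_one] at h1
  exact (ENNReal.toReal_le_toReal hfin.ne hτ).1 h1

end TraceAverage

end TracePreservingAction

namespace SFNTrace

/-! ### Estimates for `‖·‖_p` on elements of finite support -/

section Estimates

open VonNeumannAlgebra

variable {H : Type u} [NormedAddCommGroup H] [InnerProductSpace ℂ H] [CompleteSpace H]
  {M : VonNeumannAlgebra H} (τ : SFNTrace M)

theorem le_norm_of_mem_spectrum {z : M} (hz : 0 ≤ z) {t : ℝ} (ht : t ∈ spectrum ℝ z) :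
    t ≤ ‖z‖ := by
  have h := norm_apply_le_norm_cfc (fun t : ℝ => t) z ht continuousOn_id hz.isSelfAdjoint
  rw [cfc_id' ℝ z] at h
  exact (le_abs_self t).trans h

theorem map_mul_self_lt_top {z : M} (hz : 0 ≤ z) (hτ : τ z < ∞) : τ (z * z) < ∞ := by
  have h0 : 0 ≤ z * z := by
    have := star_mul_self_nonneg z
    rwa [hz.isSelfAdjoint.star_eq] at this
  have h1 : z * z ≤ ‖z‖ • z := by
    rw [← cfc_const_mul_id ‖z‖ z]
    nth_rw 1 2 [← cfc_id' ℝ z]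
    rw [← cfc_mul (fun t : ℝ => t) (fun t => t) z]
    refine cfc_mono (fun t ht => ?_)
    have ht0 : 0 ≤ t := spectrum_nonneg_of_nonneg hz ht
    have ht1 : t ≤ ‖z‖ := le_norm_of_mem_spectrum hz ht
    gcongr
  refine (τ.mono h0 h1).trans_lt ?_
  rw [map_smul_real τ (norm_nonneg z) hz]
  exact ENNReal.mul_lt_top ENNReal.ofReal_lt_top hτ

theorem map_lt_top_of_proj_mul_eq {z e : M} (hz : 0 ≤ z) (he : IsStarProjection e)
    (hez : e * z = z) (hτ : τ e < ∞) : τ z < ∞ := by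
  have hes := he.isSelfAdjoint.star_eq
  have hze : z * e = z := by
    have := congrArg star hez
    rwa [star_mul, hes, hz.isSelfAdjoint.star_eq] at this
  have h := τ.map_conjugate_lt_top hz (c := e) (by rwa [hes, he.isIdempotentElem.eq])
  rwa [hes, hez, hze] at h

theorem map_sqrt_lt_top {x : M} (hx : x ∈ τ.finSuppPos) : τ (CFC.sqrt x) < ∞ := by
  obtain ⟨hx0, e, he, hex, hτ⟩ := hx
  have hs0 : 0 ≤ CFC.sqrt x := CFC.sqrt_nonneg x
  refine τ.map_lt_top_of_proj_mul_eq hs0 he ?_ hτ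
  have h : (CFC.sqrt x - e * CFC.sqrt x) * star (CFC.sqrt x - e * CFC.sqrt x) = 0 := by
    have h1 : star (CFC.sqrt x - e * CFC.sqrt x) = CFC.sqrt x - CFC.sqrt x * e := by
      rw [star_sub, star_mul, hs0.isSelfAdjoint.star_eq, he.isSelfAdjoint.star_eq]
    have h2 : (CFC.sqrt x - e * CFC.sqrt x) * (CFC.sqrt x - CFC.sqrt x * e) =
        (CFC.sqrt x * CFC.sqrt x - e * (CFC.sqrt x * CFC.sqrt x)) -
        (CFC.sqrt x * CFC.sqrt x - e * (CFC.sqrt x * CFC.sqrt x)) * e := by noncomm_ring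
    rw [h1, h2, CFC.sqrt_mul_sqrt_self x hx0, hex, sub_self, zero_mul, sub_zero]
  rw [CStarRing.mul_star_self_eq_zero_iff, sub_eq_zero] at h
  exact h.symm

/-- The identity `τ((r - c²)²) = τ(r²) + τ(c⁴) - 2 τ(c r c)`, in a form that avoids the trace of
non-positive elements. It results from comparing `(c + c r)* (c + c r)` with
`(c + c r) (c + c r)*`. -/
theorem map_sub_mul_self_add {c r : M} (hc : IsSelfAdjoint c) (hr : 0 ≤ r)
    (hτ : τ (c * c) < ∞) :
    τ ((r - c * c) * (r - c * c)) + 2 * τ (c * r * c) =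
      τ (r * r) + τ (c * c * (c * c)) := by
  have hcs := hc.star_eq
  have hrs := hr.isSelfAdjoint.star_eq
  have hsq : ∀ a : M, IsSelfAdjoint a → 0 ≤ a * a := fun a ha => by
    have := star_mul_self_nonneg a
    rwa [ha.star_eq] at this
  have hcc : IsSelfAdjoint (c * c) := (hsq c hc).isSelfAdjoint
  have hd : 0 ≤ (r - c * c) * (r - c * c) := hsq _ (hr.isSelfAdjoint.sub hcc)
  have hcrc : 0 ≤ c * r * c := by
    have := conjugate_nonneg hr c
    rwa [hcs] at this
  have hrccr : 0 ≤ r * (c * c) * r := by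
    have := conjugate_nonneg (hsq c hc) r
    rwa [hrs] at this
  have hcrrc : 0 ≤ c * (r * r) * c := by
    have := conjugate_nonneg (hsq r hr.isSelfAdjoint) c
    rwa [hcs] at this
  have hY : τ (r * (c * c) * r) = τ (c * (r * r) * c) := by
    have := τ.map_star_mul_self' (c * r)
    rw [star_mul, hcs, hrs] at this
    simpa only [mul_assoc] using this
  have hYfin : τ (c * (r * r) * c) < ∞ := by
    have := τ.map_conjugate_lt_top (hsq r hr.isSelfAdjoint) (c := c) (by rwa [hcs])
    rwa [hcs] at this
  have hP0 : 0 ≤ star (c + c * r) * (c + c * r) := star_mul_self_nonneg _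
  have h1 : τ (star (c + c * r) * (c + c * r)) =
      τ (c * c) + 2 * τ (c * r * c) + τ (c * (r * r) * c) := by
    rw [τ.map_star_mul_self']
    have : (c + c * r) * star (c + c * r) = c * c + (c * r * c + c * r * c) + c * (r * r) * c := by
      rw [star_add, star_mul, hcs, hrs]
      noncomm_ring
    rw [this, τ.map_add' _ _ (add_nonneg (hsq c hc) (add_nonneg hcrc hcrc)) hcrrc,
      τ.map_add' _ _ (hsq c hc) (add_nonneg hcrc hcrc), τ.map_add' _ _ hcrc hcrc, two_mul]
  have h2 : star (c + c * r) * (c + c * r) + (r - c * c) * (r - c * c) =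
      c * c + r * (c * c) * r + (r * r + c * c * (c * c)) := by
    rw [star_add, star_mul, hcs, hrs]
    noncomm_ring
  have h3 := congrArg τ h2
  rw [τ.map_add' _ _ hP0 hd, h1,
    τ.map_add' _ _ (add_nonneg (hsq c hc) hrccr) (add_nonneg (hsq r hr.isSelfAdjoint) (hsq _ hcc)),
    τ.map_add' _ _ (hsq c hc) hrccr,
    τ.map_add' _ _ (hsq r hr.isSelfAdjoint) (hsq _ hcc), hY] at h3
  have hfin : τ (c * c) + τ (c * (r * r) * c) ≠ ∞ := ENNReal.add_ne_top.2 ⟨hτ.ne, hYfin.ne⟩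
  rw [← ENNReal.add_right_inj hfin, ← h3]
  ring

/-- An `L_1`-estimate for a difference of squares, from
`± (r² - s²) ≤ ½ (t (r + s)² + t⁻¹ (r - s)²)` with `t = δ²`. -/
theorem map_abs_sq_sub_sq_le {r s : M} (hr : IsSelfAdjoint r) (hs : IsSelfAdjoint s) {δ : ℝ}
    (hδ : 0 < δ) :
    τ (CFC.abs (r * r - s * s)) ≤ ENNReal.ofReal (δ ^ 2) * (2 * (τ (r * r) + τ (s * s))) +
      ENNReal.ofReal ((δ ^ 2)⁻¹) * τ ((r - s) * (r - s)) := by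
  have hsq : ∀ a : M, IsSelfAdjoint a → 0 ≤ a * a := fun a ha => by
    have := star_mul_self_nonneg a
    rwa [ha.star_eq] at this
  have hrr := hsq r hr
  have hss := hsq s hs
  have hd := hsq _ (hr.sub hs)
  have hu := hsq _ (hr.add hs)
  have hy : IsSelfAdjoint (r * r - s * s) := hrr.isSelfAdjoint.sub hss.isSelfAdjoint
  have hδ2 : (0 : ℝ) ≤ δ ^ 2 := by positivity
  have hδ2' : (0 : ℝ) ≤ (δ ^ 2)⁻¹ := by positivity
  set B : M := (δ ^ 2) • ((r + s) * (r + s)) + (δ ^ 2)⁻¹ • ((r - s) * (r - s)) with hB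
  have hB0 : 0 ≤ B := add_nonneg (smul_nonneg hδ2 hu) (smul_nonneg hδ2' hd)
  have hA0 : 0 ≤ (2⁻¹ : ℝ) • B := smul_nonneg (by norm_num) hB0
  have hsa : ∀ t : ℝ, IsSelfAdjoint (δ • (r + s) + t • (r - s)) := fun t =>
    ((IsSelfAdjoint.all δ).smul (hr.add hs)).add ((IsSelfAdjoint.all t).smul (hr.sub hs))
  have hexp : ∀ t : ℝ, (δ • (r + s) + t • (r - s)) * (δ • (r + s) + t • (r - s)) =
      (δ ^ 2) • ((r + s) * (r + s)) + (t ^ 2) • ((r - s) * (r - s)) +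
        (δ * t) • ((2 : ℝ) • (r * r - s * s)) := by
    intro t
    have h2 : (2 : ℝ) • (r * r - s * s) = (r + s) * (r - s) + (r - s) * (r + s) := by
      rw [two_smul]
      noncomm_ring
    rw [h2]
    generalize r + s = a
    generalize r - s = b
    simp only [mul_add, add_mul, smul_mul_smul_comm, smul_add, sq, mul_comm t δ]
    abel
  have hle1 : r * r - s * s ≤ (2⁻¹ : ℝ) • B := by
    have h := hsq _ (hsa (-δ⁻¹))
    rw [hexp, neg_sq, inv_pow, mul_neg, mul_inv_cancel₀ hδ.ne', neg_smul, one_smul,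
      ← sub_eq_add_neg, sub_nonneg] at h
    have := smul_le_smul_of_nonneg_left h (show (0 : ℝ) ≤ 2⁻¹ by norm_num)
    rwa [smul_smul, inv_mul_cancel₀ (two_ne_zero), one_smul] at this
  have hle2 : -(r * r - s * s) ≤ (2⁻¹ : ℝ) • B := by
    have h := hsq _ (hsa (δ⁻¹))
    rw [hexp, inv_pow, mul_inv_cancel₀ hδ.ne', one_smul, ← neg_le_iff_add_nonneg', neg_le,
      ← smul_neg] at h
    have := smul_le_smul_of_nonneg_left h (show (0 : ℝ) ≤ 2⁻¹ by norm_num)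
    rwa [smul_smul, inv_mul_cancel₀ (two_ne_zero), one_smul] at this
  have hu2 : τ ((r + s) * (r + s)) ≤ 2 * (τ (r * r) + τ (s * s)) := by
    have h1 : (r + s) * (r + s) ≤ (r * r + s * s) + (r * r + s * s) := by
      rw [← sub_nonneg]
      convert hd using 1
      noncomm_ring
    refine (τ.mono hu h1).trans_eq ?_
    rw [τ.map_add' _ _ (add_nonneg hrr hss) (add_nonneg hrr hss), τ.map_add' _ _ hrr hss, two_mul]
  calc τ (CFC.abs (r * r - s * s))
      = τ ((r * r - s * s)⁺) + τ ((-(r * r - s * s))⁺) := by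
        rw [← CFC.posPart_add_negPart _ hy, CFC.posPart_neg,
          τ.map_add' _ _ (CFC.posPart_nonneg _) (CFC.negPart_nonneg _)]
    _ ≤ τ ((2⁻¹ : ℝ) • B) + τ ((2⁻¹ : ℝ) • B) :=
        add_le_add (τ.map_posPart_le_of_le hy hA0 hle1) (τ.map_posPart_le_of_le hy.neg hA0 hle2)
    _ = τ B := by
        rw [← τ.map_add' _ _ hA0 hA0, ← two_smul ℝ, smul_smul, mul_inv_cancel₀ two_ne_zero,
          one_smul]
    _ = ENNReal.ofReal (δ ^ 2) * τ ((r + s) * (r + s)) +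
        ENNReal.ofReal ((δ ^ 2)⁻¹) * τ ((r - s) * (r - s)) := by
        rw [hB, τ.map_add' _ _ (smul_nonneg hδ2 hu) (smul_nonneg hδ2' hd),
          τ.map_smul_real hδ2 hu, τ.map_smul_real hδ2' hd]
    _ ≤ _ := by gcongr

theorem map_abs_rpow_le {p : ℝ} (hp : 1 ≤ p) (y : M) :
    τ (CFC.abs y ^ p) ≤ ENNReal.ofReal (‖y‖ ^ (p - 1)) * τ (CFC.abs y) := by
  have hb : 0 ≤ CFC.abs y := CFC.abs_nonneg y
  rw [← τ.map_smul_real (by positivity) hb]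
  refine τ.mono CFC.rpow_nonneg ?_
  rw [CFC.rpow_eq_cfc_real hb, ← cfc_const_mul_id (‖y‖ ^ (p - 1)) (CFC.abs y)]
  have hcont : ContinuousOn (fun t : ℝ => t ^ p) (spectrum ℝ (CFC.abs y)) :=
    (Real.continuous_rpow_const (by linarith)).continuousOn
  refine cfc_mono (fun t ht => ?_) hcont
  have ht0 : 0 ≤ t := spectrum_nonneg_of_nonneg hb ht
  have ht1 : t ≤ ‖y‖ := by
    have := le_norm_of_mem_spectrum hb ht
    rwa [CFC.norm_abs] at this
  rcases ht0.eq_or_lt with rfl | ht0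
  · rw [Real.zero_rpow (by linarith)]
    simp
  · calc t ^ p = t ^ (p - 1) * t := by
          rw [← Real.rpow_add_one ht0.ne', sub_add_cancel]
      _ ≤ ‖y‖ ^ (p - 1) * t := by gcongr

theorem lpNorm_nonneg (p : ℝ) (x : M) : 0 ≤ τ.lpNorm p x :=
  Real.rpow_nonneg ENNReal.toReal_nonneg _

theorem lpSeminorm_le_lpNorm (p : ℝ) (x : τ.finSupp) : τ.lpSeminorm p x ≤ τ.lpNorm p x := by
  have hb : BddAbove {q : Seminorm ℂ τ.finSupp | ∀ y, q y ≤ τ.lpNorm p y} :=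
    Seminorm.bddAbove_iff.2 ⟨fun y => τ.lpNorm p y, by rintro _ ⟨q, hq, rfl⟩ y; exact hq y⟩
  have hne : Nonempty {q : Seminorm ℂ τ.finSupp | ∀ y, q y ≤ τ.lpNorm p y} :=
    ⟨⟨0, fun y => τ.lpNorm_nonneg p y⟩⟩
  rw [lpSeminorm, Seminorm.sSup_apply hb]
  exact ciSup_le fun q => q.2 x

theorem norm_toLp (p : ℝ) (x : τ.finSupp) : ‖τ.toLp p x‖ = τ.lpSeminorm p x :=
  UniformSpace.Completion.norm_coe _

theorem toLp_add (p : ℝ) (x y : τ.finSupp) : τ.toLp p (x + y) = τ.toLp p x + τ.toLp p y :=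
  UniformSpace.Completion.coe_add _ _

theorem toLp_smul (p : ℝ) (c : ℂ) (x : τ.finSupp) : τ.toLp p (c • x) = c • τ.toLp p x :=
  UniformSpace.Completion.coe_smul c _

theorem toLp_smul_real (p : ℝ) (r : ℝ) (x : τ.finSupp) :
    τ.toLp p ((r : ℂ) • x) = r • τ.toLp p x :=
  UniformSpace.Completion.coe_smul r (τ.toLpCore p x)

theorem toLp_sub (p : ℝ) (x y : τ.finSupp) : τ.toLp p (x - y) = τ.toLp p x - τ.toLp p y :=
  UniformSpace.Completion.coe_sub _ _

theorem toLp_zero (p : ℝ) : τ.toLp p 0 = 0 := UniformSpace.Completion.coe_zero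

theorem Lp_induction {p : ℝ} {P : τ.Lp p → Prop} (v : τ.Lp p) (hP : IsClosed {v | P v})
    (h : ∀ x, P (τ.toLp p x)) : P v :=
  UniformSpace.Completion.induction_on v hP h

/-! ### The positive cone of `L_p(M)` -/

theorem isClosed_LpPos (p : ℝ) : IsClosed (τ.LpPos p) := isClosed_closure

theorem zero_mem_LpPos (p : ℝ) : (0 : τ.Lp p) ∈ τ.LpPos p :=
  subset_closure ⟨0, le_refl (0 : M), τ.toLp_zero p⟩

theorem add_mem_LpPos (p : ℝ) {a b : τ.Lp p} (ha : a ∈ τ.LpPos p) (hb : b ∈ τ.LpPos p) :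
    a + b ∈ τ.LpPos p := by
  refine map_mem_closure₂ continuous_add ha hb ?_
  rintro _ ⟨x, hx, rfl⟩ _ ⟨y, hy, rfl⟩
  exact ⟨x + y, add_nonneg (α := M) hx hy, τ.toLp_add p x y⟩

theorem smul_mem_LpPos (p : ℝ) {r : ℝ} (hr : 0 ≤ r) {a : τ.Lp p} (ha : a ∈ τ.LpPos p) :
    r • a ∈ τ.LpPos p := by
  refine map_mem_closure (continuous_const_smul r) ha ?_
  rintro _ ⟨x, hx, rfl⟩
  refine ⟨(r : ℂ) • x, ?_, τ.toLp_smul_real p r x⟩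
  have hx' : (0 : M) ≤ x := hx
  have : (0 : M) ≤ r • (x : M) := smul_nonneg hr hx'
  rwa [← Complex.coe_smul] at this

theorem convex_LpPos (p : ℝ) : Convex ℝ (τ.LpPos p) :=
  fun _ ha _ hb _ _ hs ht _ =>
    τ.add_mem_LpPos p (τ.smul_mem_LpPos p hs ha) (τ.smul_mem_LpPos p ht hb)

theorem integral_mem_LpPos (p : ℝ) {Ω : Type*} [MeasurableSpace Ω] (μ : Measure Ω)
    [IsFiniteMeasure μ] {f : Ω → τ.Lp p} (hf : ∀ s, f s ∈ τ.LpPos p) (hi : Integrable f μ) :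
    ∫ s, f s ∂μ ∈ τ.LpPos p := by
  rcases eq_or_ne μ 0 with rfl | hμ
  · rw [integral_zero_measure]
    exact τ.zero_mem_LpPos p
  · have : NeZero μ := ⟨hμ⟩
    rw [← measure_smul_average]
    exact τ.smul_mem_LpPos p measureReal_nonneg
      ((τ.convex_LpPos p).average_mem (τ.isClosed_LpPos p) (Eventually.of_forall hf) hi)

end Estimates

end SFNTrace

namespace TracePreservingAction

/-! ### Strong continuity and averages on `L_p(M)` -/

section LpAction

open SFNTrace

variable {G : Type v} [Group G] [TopologicalSpace G] {H : Type u}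
  [NormedAddCommGroup H] [InnerProductSpace ℂ H] [CompleteSpace H] {M : VonNeumannAlgebra H}
  {τ : SFNTrace M} (α : TracePreservingAction G τ)

theorem onLp_toLp (p : ℝ) (g : G) (x : τ.finSupp) :
    α.onLp p g (τ.toLp p x) = τ.toLp p (α.coreMap g x) :=
  ContinuousLinearMap.completion_apply_coe _ _

theorem norm_onLp_le (p : ℝ) (g : G) (v : τ.Lp p) : ‖α.onLp p g v‖ ≤ ‖v‖ := by
  refine τ.Lp_induction v (isClosed_le (α.onLp p g).continuous.norm continuous_norm) fun x => ?_
  rw [onLp_toLp, norm_toLp, norm_toLp]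
  exact α.lpSeminorm_coreMap_le p g x

theorem onLp_mul (p : ℝ) (g h : G) (v : τ.Lp p) :
    α.onLp p (g * h) v = α.onLp p g (α.onLp p h v) := by
  refine τ.Lp_induction v (isClosed_eq (α.onLp p (g * h)).continuous
    ((α.onLp p g).continuous.comp (α.onLp p h).continuous)) fun x => ?_
  rw [Function.comp_apply, onLp_toLp, onLp_toLp, onLp_toLp]
  exact congrArg (τ.toLp p) (Subtype.ext (α.map_mul_apply g h x))

theorem onLp_one (p : ℝ) (v : τ.Lp p) : α.onLp p 1 v = v := by
  refine τ.Lp_induction (P := fun v => α.onLp p 1 v = v) v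
    (isClosed_eq (α.onLp p 1).continuous continuous_id) fun x => ?_
  rw [onLp_toLp]
  exact congrArg (τ.toLp p) (Subtype.ext (α.map_one_apply x))

theorem onLp_mem_LpPos (p : ℝ) (g : G) {v : τ.Lp p} (hv : v ∈ τ.LpPos p) :
    α.onLp p g v ∈ τ.LpPos p := by
  refine map_mem_closure (α.onLp p g).continuous hv ?_
  rintro _ ⟨x, hx, rfl⟩
  exact ⟨α.coreMap g x, α.map_nonneg g hx, (α.onLp_toLp p g x).symm⟩

/-- Strong continuity at the identity for `‖·‖_2` on square roots of elements of `S₊`: it follows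
from weak* continuity because the norm is preserved. -/
theorem tendsto_trace_sub_mul_self {x : M} (hx : x ∈ τ.finSuppPos) :
    Tendsto (fun g => (τ ((α g (CFC.sqrt x) - CFC.sqrt x) *
      (α g (CFC.sqrt x) - CFC.sqrt x))).toReal) (𝓝 1) (𝓝 0) := by
  set s := CFC.sqrt x with hs
  have hs0 : 0 ≤ s := CFC.sqrt_nonneg x
  have hss : s * s = x := CFC.sqrt_mul_sqrt_self x hx.1
  have hsτ : τ s < ∞ := τ.map_sqrt_lt_top hx
  have hssτ : τ (s * s) < ∞ := τ.map_mul_self_lt_top hs0 hsτ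
  set c := CFC.sqrt s with hc
  have hc0 : 0 ≤ c := CFC.sqrt_nonneg s
  have hcs := hc0.isSelfAdjoint.star_eq
  have hcc : c * c = s := CFC.sqrt_mul_sqrt_self s hs0
  obtain ⟨f, hf, hfz⟩ := τ.exists_mem_predual_conjugate hc0.isSelfAdjoint (by rwa [hcc])
  have hcont : Continuous fun g => f (α g s) :=
    VonNeumannAlgebra.continuous_of_mem_predual (fun g => (α.norm_map g s).le)
      (α.continuous_inner s) hf
  have hid : ∀ g, (τ ((α g s - s) * (α g s - s))).toReal =
      2 * (τ (s * s)).toReal - 2 * (f (α g s)).re := by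
    intro g
    have hgs := α.map_nonneg g hs0
    have h1 := τ.map_sub_mul_self_add hc0.isSelfAdjoint hgs (by rwa [hcc])
    have h2 : τ (α g s * α g s) = τ (s * s) := by
      rw [← map_mul, hss, α.trace_map' g x hx.1]
    rw [hcc, h2, ← two_mul] at h1
    have hne : 2 * τ (s * s) ≠ ∞ := ENNReal.mul_ne_top (by simp) hssτ.ne
    rw [← h1, ENNReal.add_ne_top] at hne
    have h3 := congrArg ENNReal.toReal h1
    rw [ENNReal.toReal_add hne.1 hne.2, ENNReal.toReal_mul, ENNReal.toReal_mul] at h3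
    rw [hfz _ hgs, Complex.ofReal_re]
    simp only [ENNReal.toReal_ofNat] at h3
    linarith
  simp only [hid]
  have hlim : Tendsto (fun g => 2 * (τ (s * s)).toReal - 2 * (f (α g s)).re) (𝓝 1)
      (𝓝 (2 * (τ (s * s)).toReal - 2 * (f (α 1 s)).re)) :=
    (continuous_const.sub (continuous_const.mul (Complex.continuous_re.comp hcont))).tendsto 1
  have h0 : 2 * (τ (s * s)).toReal - 2 * (f (α 1 s)).re = 0 := by
    have : c * s * c = s * s := by
      rw [← hcc]
      noncomm_ring
    rw [α.map_one_apply, hfz s hs0, Complex.ofReal_re, this, sub_self]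
  rwa [h0] at hlim

theorem tendsto_trace_abs_sub {x : M} (hx : x ∈ τ.finSuppPos) :
    Tendsto (fun g => (τ (CFC.abs (α g x - x))).toReal) (𝓝 1) (𝓝 0) := by
  have hD := α.tendsto_trace_sub_mul_self hx
  set s := CFC.sqrt x with hs
  have hs0 : 0 ≤ s := CFC.sqrt_nonneg x
  have hss : s * s = x := CFC.sqrt_mul_sqrt_self x hx.1
  have hxτ : τ x < ∞ := by
    rw [← hss]
    exact τ.map_mul_self_lt_top hs0 (τ.map_sqrt_lt_top hx)
  have hfin : ∀ g, τ ((α g s - s) * (α g s - s)) < ∞ := by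
    intro g
    have hgs := α.map_nonneg g hs0
    have h1 := τ.map_sub_mul_self_add (CFC.sqrt_nonneg s).isSelfAdjoint hgs (by
      rw [CFC.sqrt_mul_sqrt_self s hs0]; exact τ.map_sqrt_lt_top hx)
    rw [CFC.sqrt_mul_sqrt_self s hs0, ← map_mul, hss, α.trace_map' g x hx.1] at h1
    exact (le_self_add.trans_eq h1).trans_lt (ENNReal.add_lt_top.2 ⟨hxτ, hxτ⟩)
  have hbd : ∀ (δ : ℝ), 0 < δ → ∀ g, (τ (CFC.abs (α g x - x))).toReal ≤
      δ ^ 2 * (4 * (τ x).toReal) +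
        (δ ^ 2)⁻¹ * (τ ((α g s - s) * (α g s - s))).toReal := by
    intro δ hδ g
    have h := τ.map_abs_sq_sub_sq_le (α.map_nonneg g hs0).isSelfAdjoint hs0.isSelfAdjoint hδ
    rw [← map_mul, hss, α.trace_map' g x hx.1] at h
    have hA : ENNReal.ofReal (δ ^ 2) * (2 * (τ x + τ x)) ≠ ∞ :=
      ENNReal.mul_ne_top ENNReal.ofReal_ne_top
        (ENNReal.mul_ne_top (by simp) (ENNReal.add_ne_top.2 ⟨hxτ.ne, hxτ.ne⟩))
    have hB : ENNReal.ofReal ((δ ^ 2)⁻¹) * τ ((α g s - s) * (α g s - s)) ≠ ∞ :=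
      ENNReal.mul_ne_top ENNReal.ofReal_ne_top (hfin g).ne
    refine (ENNReal.toReal_mono (ENNReal.add_ne_top.2 ⟨hA, hB⟩) h).trans_eq ?_
    rw [ENNReal.toReal_add hA hB, ENNReal.toReal_mul, ENNReal.toReal_mul, ENNReal.toReal_mul,
      ENNReal.toReal_add hxτ.ne hxτ.ne, ENNReal.toReal_ofReal (by positivity),
      ENNReal.toReal_ofReal (by positivity), ENNReal.toReal_ofNat]
    ring
  rw [Metric.tendsto_nhds]
  intro ε hε
  set X := (τ x).toReal
  have hX : 0 ≤ X := ENNReal.toReal_nonneg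
  -- with this `δ` the first term of `hbd` is at most `ε / 2`
  set δ := √(ε / (8 * X + 1)) with hδ
  have hδ0 : 0 < δ := Real.sqrt_pos.2 (by positivity)
  have hδ2 : δ ^ 2 = ε / (8 * X + 1) := Real.sq_sqrt (by positivity)
  have hev := (Metric.tendsto_nhds.1 hD) (δ ^ 2 * (ε / 2)) (by positivity)
  filter_upwards [hev] with g hg
  rw [dist_zero_right, Real.norm_of_nonneg ENNReal.toReal_nonneg] at hg ⊢
  refine (hbd δ hδ0 g).trans_lt ?_
  have h1 : δ ^ 2 * (4 * X) ≤ ε / 2 := by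
    rw [hδ2, div_mul_eq_mul_div, div_le_iff₀ (by positivity)]
    nlinarith
  have h2 : (δ ^ 2)⁻¹ * (τ ((α g s - s) * (α g s - s))).toReal < ε / 2 := by
    rw [inv_mul_lt_iff₀ (by positivity)]
    exact hg
  linarith

theorem tendsto_lpNorm_sub {p : ℝ} (hp : 1 ≤ p) {x : M} (hx : x ∈ τ.finSuppPos) :
    Tendsto (fun g => τ.lpNorm p (α g x - x)) (𝓝 1) (𝓝 0) := by
  have hL := α.tendsto_trace_abs_sub hx
  have hxτ : τ x < ∞ := by
    obtain ⟨hx0, e, he, hex, hτ⟩ := hx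
    exact τ.map_lt_top_of_proj_mul_eq hx0 he hex hτ
  have hfin : ∀ g, τ (CFC.abs (α g x - x)) ≠ ∞ := by
    intro g
    have hy : IsSelfAdjoint (α g x - x) :=
      (α.map_nonneg g hx.1).isSelfAdjoint.sub hx.1.isSelfAdjoint
    have h1 := τ.map_posPart_le_of_le hy (α.map_nonneg g hx.1) (sub_le_self _ hx.1)
    have h2 := τ.map_posPart_le_of_le hy.neg hx.1 (by
      rw [neg_sub]
      exact sub_le_self _ (α.map_nonneg g hx.1))
    rw [CFC.posPart_neg] at h2
    rw [α.trace_map' g x hx.1] at h1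
    rw [← CFC.posPart_add_negPart _ hy,
      τ.map_add' _ _ (CFC.posPart_nonneg _) (CFC.negPart_nonneg _)]
    exact ENNReal.add_ne_top.2 ⟨(h1.trans_lt hxτ).ne, (h2.trans_lt hxτ).ne⟩
  have h1 : Tendsto (fun g => (τ (CFC.abs (α g x - x) ^ p)).toReal) (𝓝 1) (𝓝 0) := by
    refine squeeze_zero (fun _ => ENNReal.toReal_nonneg) (fun g => ?_)
      (by simpa using hL.const_mul ((2 * ‖x‖) ^ (p - 1)))
    have hn : ‖α g x - x‖ ≤ 2 * ‖x‖ := by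
      refine (norm_sub_le _ _).trans_eq ?_
      rw [α.norm_map, two_mul]
    refine (ENNReal.toReal_mono (ENNReal.mul_ne_top ENNReal.ofReal_ne_top (hfin g))
      (τ.map_abs_rpow_le hp (α g x - x))).trans ?_
    rw [ENNReal.toReal_mul, ENNReal.toReal_ofReal (by positivity)]
    exact mul_le_mul_of_nonneg_right (Real.rpow_le_rpow (norm_nonneg _) hn (by linarith))
      ENNReal.toReal_nonneg
  have h2 := h1.rpow_const (p := 1 / p) (Or.inr (by positivity))
  rw [Real.zero_rpow (by positivity)] at h2
  exact h2

theorem tendsto_onLp_one {p : ℝ} (hp : 1 ≤ p) (v : τ.Lp p) :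
    Tendsto (fun g => α.onLp p g v) (𝓝 1) (𝓝 v) := by
  let W : Submodule ℂ (τ.Lp p) :=
    { carrier := {v | Tendsto (fun g => α.onLp p g v) (𝓝 1) (𝓝 v)}
      add_mem' := fun {a b} ha hb => by
        simpa only [Set.mem_ofPred_eq, map_add] using Tendsto.add ha hb
      zero_mem' := by
        simpa only [Set.mem_ofPred_eq, _root_.map_zero] using tendsto_const_nhds
      smul_mem' := fun c a ha => by
        simpa only [Set.mem_ofPred_eq, map_smul] using Tendsto.const_smul ha c }
  have hcl : IsClosed (W : Set (τ.Lp p)) := by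
    refine isClosed_of_closure_subset fun v hv => ?_
    change Tendsto (fun g => α.onLp p g v) (𝓝 1) (𝓝 v)
    rw [Metric.tendsto_nhds]
    intro ε hε
    obtain ⟨w, hw, hvw⟩ := Metric.mem_closure_iff.1 hv (ε / 3) (by positivity)
    have hw' : Tendsto (fun g => α.onLp p g w) (𝓝 1) (𝓝 w) := hw
    filter_upwards [Metric.tendsto_nhds.1 hw' (ε / 3) (by positivity)] with g hg
    have h1 : dist (α.onLp p g v) (α.onLp p g w) ≤ dist v w := by
      rw [dist_eq_norm, dist_eq_norm, ← map_sub]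
      exact α.norm_onLp_le p g _
    have h2 := dist_triangle4 (α.onLp p g v) (α.onLp p g w) w v
    rw [dist_comm w v] at h2
    linarith
  have hS : ∀ (x : M) (hx : x ∈ τ.finSupp), τ.toLp p ⟨x, hx⟩ ∈ W := by
    intro x hx
    induction hx using Submodule.span_induction with
    | mem x hx =>
      change Tendsto _ _ _
      rw [tendsto_iff_norm_sub_tendsto_zero]
      refine squeeze_zero (fun _ => norm_nonneg _) (fun g => ?_) (α.tendsto_lpNorm_sub hp hx)
      rw [onLp_toLp, ← toLp_sub, norm_toLp]
      exact τ.lpSeminorm_le_lpNorm p _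
    | zero => exact (τ.toLp_zero p).symm ▸ W.zero_mem
    | add x y hx hy ihx ihy => exact (τ.toLp_add p ⟨x, hx⟩ ⟨y, hy⟩).symm ▸ W.add_mem ihx ihy
    | smul c x hx ih => exact (τ.toLp_smul p c ⟨x, hx⟩).symm ▸ W.smul_mem c ih
  exact τ.Lp_induction v hcl fun x => hS x.1 x.2

variable [IsTopologicalGroup G]

theorem continuous_onLp {p : ℝ} (hp : 1 ≤ p) (v : τ.Lp p) :
    Continuous fun g => α.onLp p g v := by
  rw [continuous_iff_continuousAt]
  intro h
  have h1 : Tendsto (fun g => h⁻¹ * g) (𝓝 h) (𝓝 1) := by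
    have : Continuous fun g : G => h⁻¹ * g := continuous_const.mul continuous_id
    simpa using this.tendsto h
  have h2 := ((α.onLp p h).continuous.tendsto v).comp ((α.tendsto_onLp_one hp v).comp h1)
  refine h2.congr fun g => ?_
  simp only [Function.comp_apply]
  rw [← onLp_mul, mul_inv_cancel_left]

variable [SecondCountableTopology G] [MeasurableSpace G] [BorelSpace G]

theorem integrable_onLp {p : ℝ} (hp : 1 ≤ p) (v : τ.Lp p) (μ : Measure G) [IsFiniteMeasure μ] :
    Integrable (fun g => α.onLp p g v) μ :=
  Integrable.of_bound (α.continuous_onLp hp v).aestronglyMeasurable ‖v‖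
    (Eventually.of_forall fun g => α.norm_onLp_le p g v)

/-- The average `v ↦ ∫ α_g(v) dμ(g)` of the action on `L_p(M)` for a finite measure `μ`. -/
noncomputable def lpAvg {p : ℝ} (hp : 1 ≤ p) (μ : Measure G) [IsFiniteMeasure μ] :
    τ.Lp p →L[ℂ] τ.Lp p :=
  LinearMap.mkContinuous
    { toFun := fun v => ∫ g, α.onLp p g v ∂μ
      map_add' := fun v w => by
        simp only [map_add]
        exact integral_add (α.integrable_onLp hp v μ) (α.integrable_onLp hp w μ)
      map_smul' := fun c v => by
        simp only [map_smul]
        exact integral_smul c _ }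
    (μ.real Set.univ) fun v =>
      (norm_integral_le_of_norm_le_const
        (Eventually.of_forall fun g => α.norm_onLp_le p g v)).trans_eq (mul_comm _ _)

theorem lpAvg_apply {p : ℝ} (hp : 1 ≤ p) (μ : Measure G) [IsFiniteMeasure μ] (v : τ.Lp p) :
    α.lpAvg hp μ v = ∫ g, α.onLp p g v ∂μ := rfl

theorem lpAvg_mem_LpPos {p : ℝ} (hp : 1 ≤ p) (μ : Measure G) [IsFiniteMeasure μ] {v : τ.Lp p}
    (hv : v ∈ τ.LpPos p) : α.lpAvg hp μ v ∈ τ.LpPos p :=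
  τ.integral_mem_LpPos p μ (fun g => α.onLp_mem_LpPos p g hv) (α.integrable_onLp hp v μ)

theorem lpAvg_mconv {p : ℝ} (hp : 1 ≤ p) (μ ν : Measure G) [IsFiniteMeasure μ]
    [IsFiniteMeasure ν] (v : τ.Lp p) :
    α.lpAvg hp (μ.mconv ν) v = α.lpAvg hp μ (α.lpAvg hp ν v) := by
  rw [lpAvg_apply, integral_mconv (α.integrable_onLp hp v _), lpAvg_apply]
  refine integral_congr_ae (Eventually.of_forall fun g => ?_)
  simp only [onLp_mul]
  exact (α.onLp p g).integral_comp_comm (α.integrable_onLp hp v ν)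

theorem lpAvg_dirac_one {p : ℝ} (hp : 1 ≤ p) (v : τ.Lp p) :
    α.lpAvg hp (Measure.dirac (1 : G)) v = v := by
  rw [lpAvg_apply, integral_dirac' _ _ (α.continuous_onLp hp v).stronglyMeasurable, onLp_one]

theorem lpLE_lpAvg_of_le {p : ℝ} (hp : 1 ≤ p) {μ ν : Measure G} [IsFiniteMeasure μ]
    [IsFiniteMeasure ν] (h : μ ≤ ν) {v : τ.Lp p} (hv : v ∈ τ.LpPos p) :
    α.lpAvg hp ν v - α.lpAvg hp μ v ∈ τ.LpPos p := by
  have h1 : α.lpAvg hp ν v = α.lpAvg hp (ν - μ) v + α.lpAvg hp μ v := by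
    rw [lpAvg_apply, lpAvg_apply, lpAvg_apply, ← integral_add_measure (α.integrable_onLp hp v _)
      (α.integrable_onLp hp v _), Measure.sub_add_cancel_of_le h]
  rw [h1, add_sub_cancel_right]
  exact α.lpAvg_mem_LpPos hp _ hv

end LpAction

end TracePreservingAction

/-! ### Convolution powers and Følner sequences -/

/-- The convolution powers `ω * ⋯ * ω` of a measure on a group. -/
noncomputable def convPow {G : Type v} [Group G] [MeasurableSpace G] (ω : Measure G) :
    ℕ → Measure G
  | 0 => Measure.dirac 1
  | j + 1 => ω.mconv (convPow ω j)

section ConvPow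

variable {G : Type v} [Group G] [MeasurableSpace G]

instance isFiniteMeasure_convPow (ω : Measure G) [IsFiniteMeasure ω] (j : ℕ) :
    IsFiniteMeasure (convPow ω j) := by
  induction j with
  | zero => exact inferInstanceAs (IsFiniteMeasure (Measure.dirac 1))
  | succ j ih => exact inferInstanceAs (IsFiniteMeasure (ω.mconv (convPow ω j)))

theorem convPow_succ (ω : Measure G) (j : ℕ) : convPow ω (j + 1) = ω.mconv (convPow ω j) := rfl

variable [MeasurableMul₂ G]

theorem mconv_apply (μ ν : Measure G) [SFinite ν] {S : Set G} (hS : MeasurableSet S) :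
    μ.mconv ν S = ∫⁻ x, ν ((fun y => x * y) ⁻¹' S) ∂μ := by
  rw [Measure.mconv, Measure.map_apply measurable_mul hS,
    Measure.prod_apply (measurable_mul hS)]
  rfl

theorem mconv_apply_symm (μ ν : Measure G) [SFinite μ] [SFinite ν] {S : Set G}
    (hS : MeasurableSet S) :
    μ.mconv ν S = ∫⁻ y, μ ((fun x => x * y) ⁻¹' S) ∂ν := by
  rw [Measure.mconv, Measure.map_apply measurable_mul hS,
    Measure.prod_apply_symm (measurable_mul hS)]
  rfl

theorem mconv_mono {μ μ' ν ν' : Measure G} [SFinite ν] [SFinite ν'] (hμ : μ ≤ μ') (hν : ν ≤ ν') :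
    μ.mconv ν ≤ μ'.mconv ν' := by
  refine Measure.le_iff.2 fun S hS => ?_
  rw [mconv_apply μ ν hS, mconv_apply μ' ν' hS]
  exact lintegral_mono' hμ fun x => hν _

theorem mconv_univ (μ ν : Measure G) [SFinite ν] :
    μ.mconv ν Set.univ = μ Set.univ * ν Set.univ := by
  rw [mconv_apply μ ν MeasurableSet.univ]
  simp [mul_comm]

theorem convPow_univ (ω : Measure G) [IsFiniteMeasure ω] (j : ℕ) :
    convPow ω j Set.univ = ω Set.univ ^ j := by
  induction j with
  | zero => simp [convPow]
  | succ j ih => rw [convPow_succ, mconv_univ, ih, pow_succ']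

theorem mconv_compl_mul_eq_zero {μ ν : Measure G} [SFinite ν] {K L : Set G} (hμ : μ Kᶜ = 0)
    (hν : ν Lᶜ = 0) (hKL : MeasurableSet (K * L)) : μ.mconv ν (K * L)ᶜ = 0 := by
  rw [mconv_apply μ ν hKL.compl]
  refine lintegral_eq_zero_of_ae_eq_zero ?_
  have hK : ∀ᵐ x ∂μ, x ∈ K := hμ
  filter_upwards [hK] with x hx
  change ν ((fun y => x * y) ⁻¹' (K * L)ᶜ) = 0
  exact measure_mono_null (fun y hy (hyL : y ∈ L) => hy (Set.mul_mem_mul hx hyL)) hν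

/-- Convolving on the left with a measure carried by `K` keeps, up to the mass of that measure, the
Haar measure on the set of those `x` with `K⁻¹ x ⊆ E`. -/
theorem smul_restrict_le_mconv_left {lam : Measure G} [lam.IsMulLeftInvariant] [SFinite lam]
    {A : Measure G} {K E E' : Set G} (hA : A Kᶜ = 0)
    (h : ∀ s ∈ K, ∀ x ∈ E', s⁻¹ * x ∈ E) :
    A Set.univ • lam.restrict E' ≤ A.mconv (lam.restrict E) := by
  refine Measure.le_iff.2 fun S hS => ?_
  rw [mconv_apply _ _ hS, Measure.smul_apply, smul_eq_mul, mul_comm, ← lintegral_const]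
  refine lintegral_mono_ae ?_
  have hK : ∀ᵐ x ∂A, x ∈ K := hA
  filter_upwards [hK] with s hs
  rw [Measure.restrict_apply hS, Measure.restrict_apply (measurable_const_mul s hS),
    ← measure_preimage_mul lam s]
  refine measure_mono fun y hy => ⟨hy.1, ?_⟩
  simpa using h s hs _ hy.2

theorem smul_restrict_le_mconv_right {lam : Measure G} [lam.IsMulRightInvariant] [SFinite lam]
    {Q : Measure G} [SFinite Q] {K E E' : Set G} (hQ : Q Kᶜ = 0)
    (h : ∀ s ∈ K, ∀ x ∈ E', x * s⁻¹ ∈ E) :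
    Q Set.univ • lam.restrict E' ≤ (lam.restrict E).mconv Q := by
  refine Measure.le_iff.2 fun S hS => ?_
  rw [mconv_apply_symm _ _ hS, Measure.smul_apply, smul_eq_mul, mul_comm, ← lintegral_const]
  refine lintegral_mono_ae ?_
  have hK : ∀ᵐ x ∂Q, x ∈ K := hQ
  filter_upwards [hK] with s hs
  rw [Measure.restrict_apply hS, Measure.restrict_apply (measurable_mul_const s hS),
    ← measure_preimage_mul_right lam s]
  refine measure_mono fun y hy => ⟨hy.1, ?_⟩
  simpa using h s hs _ hy.2

end ConvPow

section Folner

variable {G : Type v} [Group G] [TopologicalSpace G] [IsTopologicalGroup G]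

theorem isCompact_pow {K : Set G} (hK : IsCompact K) (m : ℕ) : IsCompact (K ^ m) := by
  induction m with
  | zero => rw [pow_zero]; exact isCompact_singleton
  | succ m ih => rw [pow_succ]; exact ih.mul hK

variable [T2Space G] [SecondCountableTopology G] [MeasurableSpace G] [BorelSpace G]

/-- The lower bound for convolution powers behind the theorem: if `ω` dominates `A + b · λ|F'`, the
measure `A` is carried by a symmetric set `K` and `F'` contains `K^m F K^m`, then the terms of
`(A + b · λ|F')^j` with exactly one factor `b · λ|F'` are each a multiple of `λ` on `F`.
The set `K^(m-j) F` in place of `F` makes the induction work. -/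
theorem convPow_ge_of_le {lam : Measure G} [lam.IsMulLeftInvariant] [lam.IsMulRightInvariant]
    [SFinite lam] {ω A : Measure G} [IsFiniteMeasure ω] [IsFiniteMeasure A] {b : ℝ≥0}
    {K F F' : Set G} {m : ℕ} (hω : A + b • lam.restrict F' ≤ ω) (hK : IsCompact K)
    (hK1 : (1 : G) ∈ K) (hKinv : K⁻¹ = K)
    (hA : A Kᶜ = 0) (hKF : K ^ m * F * K ^ m ⊆ F') {j : ℕ} (hj : j ≤ m) :
    convPow A j + ((j : ℝ≥0∞) * A Set.univ ^ (j - 1) * b) • lam.restrict (K ^ (m - j) * F) ≤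
      convPow ω j := by
  have hAj : ∀ i, convPow A i (K ^ i)ᶜ = 0 := by
    intro i
    induction i with
    | zero => simp [convPow]
    | succ i ih =>
      rw [pow_succ']
      exact mconv_compl_mul_eq_zero hA ih (hK.mul (isCompact_pow hK i)).measurableSet
  induction j with
  | zero => simp [convPow]
  | succ j ih =>
    have ih' := ih (by omega)
    set cj : ℝ≥0∞ := (j : ℝ≥0∞) * A Set.univ ^ (j - 1) * b with hcj
    set E := K ^ (m - j) * F with hEdef
    set E' := K ^ (m - (j + 1)) * F with hE'def
    have h1 : A Set.univ • lam.restrict E' ≤ A.mconv (lam.restrict E) := by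
      refine smul_restrict_le_mconv_left hA fun s hs x hx => ?_
      have hs' : s⁻¹ ∈ K := by rw [← hKinv]; exact Set.inv_mem_inv.2 hs
      have : m - j = m - (j + 1) + 1 := by omega
      rw [hEdef, this, pow_succ', mul_assoc]
      exact Set.mul_mem_mul hs' hx
    have h2 : convPow A j Set.univ • lam.restrict E' ≤
        (lam.restrict F').mconv (convPow A j) := by
      refine smul_restrict_le_mconv_right (hAj j) fun s hs x hx => hKF ?_
      have hs' : s⁻¹ ∈ K ^ j := by
        rw [← hKinv, inv_pow]; exact Set.inv_mem_inv.2 hs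
      refine Set.mul_mem_mul ?_ (Set.pow_subset_pow_right hK1 (by omega) hs')
      exact Set.mul_subset_mul_right (Set.pow_subset_pow_right hK1 (by omega)) hx
    rw [convPow_succ, convPow_succ]
    have hscal : ((j + 1 : ℕ) : ℝ≥0∞) * A Set.univ ^ (j + 1 - 1) * b =
        cj * A Set.univ + b * convPow A j Set.univ := by
      rw [convPow_univ, hcj, add_tsub_cancel_right]
      rcases j with _ | j
      · simp
      · rw [add_tsub_cancel_right]
        push_cast
        ring
    calc A.mconv (convPow A j) +
          (((j + 1 : ℕ) : ℝ≥0∞) * A Set.univ ^ (j + 1 - 1) * b) • lam.restrict E'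
        = A.mconv (convPow A j) + (cj • (A Set.univ • lam.restrict E') +
            (b : ℝ≥0∞) • (convPow A j Set.univ • lam.restrict E')) := by
          rw [hscal, add_smul, mul_smul cj, mul_smul (b : ℝ≥0∞)]
      _ ≤ A.mconv (convPow A j) + (cj • A.mconv (lam.restrict E) +
            (b : ℝ≥0∞) • (lam.restrict F').mconv (convPow A j)) := by
          gcongr
      _ = A.mconv (convPow A j + cj • lam.restrict E) +
            (b • lam.restrict F').mconv (convPow A j) := by
          rw [Measure.mconv_add, Measure.mconv_smul_right, add_assoc]
          congr 2
          exact (Measure.mconv_smul_left _ _ _).symm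
      _ ≤ A.mconv (convPow A j + cj • lam.restrict E) +
            (b • lam.restrict F').mconv (convPow A j + cj • lam.restrict E) := by
          gcongr
          exact mconv_mono le_rfl (Measure.le_add_right le_rfl)
      _ = (A + b • lam.restrict F').mconv (convPow A j + cj • lam.restrict E) :=
          (Measure.add_mconv _ _ _).symm
      _ ≤ ω.mconv (convPow ω j) := mconv_mono hω ih'

end Folner

/-! ### A measure whose convolution powers dominate the Følner averages -/

section Construction

theorem quarter_le_pow {n : ℕ} (hn : 1 ≤ n) {i : ℕ} (hi : i ≤ 2 ^ n) :
    (1 / 4 : ℝ) ≤ (1 - (1 / 2) ^ n) ^ i := by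
  have hpow : ((1 / 2 : ℝ)) ^ n ≤ 1 := pow_le_one₀ (by norm_num) (by norm_num)
  have ha0 : (0 : ℝ) ≤ 1 - (1 / 2) ^ n := by linarith
  have ha1 : (1 : ℝ) - (1 / 2) ^ n ≤ 1 := by
    have : (0 : ℝ) ≤ (1 / 2) ^ n := by positivity
    linarith
  obtain ⟨m, rfl⟩ : ∃ m, n = m + 1 := ⟨n - 1, by omega⟩
  -- Bernoulli's inequality for half of the exponent, which is then squared
  have hB := one_add_mul_le_pow (R := ℝ) (a := -(1 / 2) ^ (m + 1)) (by linarith) (2 ^ m)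
  have h1 : (1 : ℝ) + ((2 ^ m : ℕ) : ℝ) * -(1 / 2) ^ (m + 1) = 1 / 2 := by
    have : (2 : ℝ) ^ m * (1 / 2) ^ m = 1 := by rw [← mul_pow]; norm_num
    push_cast
    rw [pow_succ]
    linarith
  rw [h1, ← sub_eq_add_neg] at hB
  calc (1 / 4 : ℝ) = (1 / 2) ^ 2 := by norm_num
    _ ≤ ((1 - (1 / 2) ^ (m + 1)) ^ 2 ^ m) ^ 2 := by gcongr
    _ = (1 - (1 / 2) ^ (m + 1)) ^ 2 ^ (m + 1) := by rw [← pow_mul, pow_succ 2 m]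
    _ ≤ _ := pow_le_pow_of_le_one ha0 ha1 hi

theorem one_le_sum_weights {n : ℕ} (hn : 1 ≤ n) {V V' : ℝ} (hV : 0 < V) (hV' : 0 < V')
    (hVV' : V' ≤ 2 * V) :
    1 ≤ 64 * V / 2 ^ n * ∑ j ∈ Finset.range (2 ^ n),
      (j : ℝ) * (1 - (1 / 2) ^ n) ^ (j - 1) * ((1 / 2) ^ (n + 1) / V') := by
  set N : ℝ := 2 ^ n with hN
  have hN2 : 2 ≤ N := by
    calc (2 : ℝ) = 2 ^ 1 := by norm_num
      _ ≤ 2 ^ n := pow_le_pow_right₀ (by norm_num) hn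
  have hb : 1 / (4 * N * V) ≤ (1 / 2 : ℝ) ^ (n + 1) / V' := by
    rw [pow_succ, one_div_pow, ← hN, div_le_div_iff₀ (by positivity) hV']
    field_simp
    linarith
  have hsum : ∑ j ∈ Finset.range (2 ^ n), (j : ℝ) = N * (N - 1) / 2 := by
    have h := Finset.sum_range_id_mul_two (2 ^ n)
    have h' := congrArg (Nat.cast (R := ℝ)) h
    rw [Nat.cast_mul, Nat.cast_mul, Nat.cast_sub Nat.one_le_two_pow] at h'
    push_cast at h'
    rw [← hN] at h'
    linarith
  have hle : ∑ j ∈ Finset.range (2 ^ n), (j : ℝ) * (1 / 4) * (1 / (4 * N * V)) ≤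
      ∑ j ∈ Finset.range (2 ^ n),
        (j : ℝ) * (1 - (1 / 2) ^ n) ^ (j - 1) * ((1 / 2) ^ (n + 1) / V') := by
    refine Finset.sum_le_sum fun j hj => ?_
    have h1 := quarter_le_pow hn (i := j - 1) (by have := Finset.mem_range.1 hj; omega)
    gcongr
  rw [← Finset.sum_mul, ← Finset.sum_mul, hsum] at hle
  calc (1 : ℝ) ≤ 64 * V / N * (N * (N - 1) / 2 * (1 / 4) * (1 / (4 * N * V))) := by
        field_simp
        linarith
    _ ≤ _ := by gcongr

theorem IsTwoSidedFolner.exists_measure_le {G : Type v} [Group G] [TopologicalSpace G]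
    [MeasurableSpace G] {lam : Measure G} {F : ℕ → Set G}
    (hF : IsTwoSidedFolner lam F) {L : Set G} (hL : IsCompact L) (i : ℕ) :
    ∃ i', i < i' ∧ lam (L * F i' * L) ≤ 2 * lam (F i') := by
  have h := (hF.tendsto L hL).eventually (gt_mem_nhds one_pos)
  obtain ⟨i', hi', hii'⟩ := (h.and (eventually_gt_atTop i)).exists
  refine ⟨i', hii', ?_⟩
  have h1 : lam ((L * F i' * L) \ F i') ≤ lam (F i') := by
    have h2 := hi'.le
    rcases eq_or_ne (lam (F i')) ∞ with ht | ht
    · rw [ht]; exact le_top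
    rwa [ENNReal.div_le_iff (hF.measure_pos i').ne' ht, one_mul] at h2
  calc lam (L * F i' * L) ≤ lam (F i' ∪ ((L * F i' * L) \ F i')) := by
        refine measure_mono fun x hx => ?_
        by_cases h : x ∈ F i'
        · exact Or.inl h
        · exact Or.inr ⟨hx, h⟩
    _ ≤ lam (F i') + lam ((L * F i' * L) \ F i') := measure_union_le _ _
    _ ≤ 2 * lam (F i') := by rw [two_mul]; gcongr

/-- A sparse subsequence of a two-sided Følner sequence, with compact symmetric sets `K n` that
contain the enlarged Følner sets `K k ^ 2 ^ k * F (φ k) * K k ^ 2 ^ k` for all `k < n`, while these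
enlargements at most double the measure. -/
theorem IsTwoSidedFolner.exists_subsequence {G : Type v} [Group G] [TopologicalSpace G]
    [IsTopologicalGroup G] [MeasurableSpace G] {lam : Measure G} {F : ℕ → Set G}
    (hF : IsTwoSidedFolner lam F) :
    ∃ (φ : ℕ → ℕ) (K : ℕ → Set G), StrictMono φ ∧ (∀ n, IsCompact (K n)) ∧
      (∀ n, (1 : G) ∈ K n) ∧ (∀ n, (K n)⁻¹ = K n) ∧
      (∀ n, lam (K n ^ 2 ^ n * F (φ n) * K n ^ 2 ^ n) ≤ 2 * lam (F (φ n))) ∧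
      ∀ k n, k < n → K k ^ 2 ^ k * F (φ k) * K k ^ 2 ^ k ⊆ K n := by
  let σ := {s : Set G × ℕ // IsCompact s.1 ∧ (1 : G) ∈ s.1 ∧ s.1⁻¹ = s.1}
  have step : ∀ (n : ℕ) (s : σ), ∃ s' : σ, s.1.2 < s'.1.2 ∧
      lam (s.1.1 ^ 2 ^ n * F s'.1.2 * s.1.1 ^ 2 ^ n) ≤ 2 * lam (F s'.1.2) ∧
      s.1.1 ⊆ s'.1.1 ∧ s.1.1 ^ 2 ^ n * F s'.1.2 * s.1.1 ^ 2 ^ n ⊆ s'.1.1 := by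
    rintro n ⟨⟨K, i⟩, hK, h1, hinv⟩
    have hKn := isCompact_pow hK (2 ^ n)
    obtain ⟨i', hi', hle⟩ := hF.exists_measure_le hKn i
    have hF' := (hKn.mul (hF.isCompact i')).mul hKn
    set F' := K ^ 2 ^ n * F i' * K ^ 2 ^ n
    refine ⟨⟨⟨K ∪ (F' ∪ F'⁻¹), i'⟩, hK.union (hF'.union hF'.inv), Or.inl h1, ?_⟩, hi', hle,
      Set.subset_union_left, fun x hx => Or.inr (Or.inl hx)⟩
    rw [Set.union_inv, Set.union_inv, inv_inv, hinv, Set.union_comm F'⁻¹]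
  choose f hf1 hf2 hf3 hf4 using step
  let st : ℕ → σ := fun n => Nat.rec
    (⟨⟨{1}, 0⟩, isCompact_singleton, rfl, by simp⟩ : σ) f n
  have hst : ∀ n, st (n + 1) = f n (st n) := fun n => rfl
  have hmono : Monotone fun n => (st n).1.1 := monotone_nat_of_le_succ fun n => by
    rw [hst]; exact hf3 n (st n)
  refine ⟨fun n => (st (n + 1)).1.2, fun n => (st n).1.1, strictMono_nat_of_lt_succ fun n => ?_,
    fun n => (st n).2.1, fun n => (st n).2.2.1, fun n => (st n).2.2.2, fun n => ?_,
    fun k n hkn => ?_⟩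
  · rw [hst (n + 1)]; exact hf1 (n + 1) (st (n + 1))
  · simp only [hst]; exact hf2 n (st n)
  · refine Set.Subset.trans ?_ (hmono (Nat.succ_le_of_lt hkn))
    simp only [hst]
    exact hf4 k (st k)

variable {G : Type v} [Group G] [TopologicalSpace G] [IsTopologicalGroup G]
  [T2Space G] [SecondCountableTopology G] [MeasurableSpace G] [BorelSpace G]

/-- Along a subsequence, the uniform measures on the Følner sets are dominated by the Cesàro means
of the convolution powers of a single probability measure. -/
theorem IsTwoSidedFolner.exists_restrict_le_convPow [LocallyCompactSpace G] {lam : Measure G}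
    [lam.IsHaarMeasure] [lam.IsMulRightInvariant] {F : ℕ → Set G} (hF : IsTwoSidedFolner lam F) :
    ∃ (φ : ℕ → ℕ) (ω : Measure G), StrictMono φ ∧ IsProbabilityMeasure ω ∧ ω ≪ lam ∧
      ∀ n, 1 ≤ n → ∃ c : ℝ≥0, (c : ℝ) = 64 * lam.real (F (φ n)) / 2 ^ n ∧
        lam.restrict (F (φ n)) ≤ c • ∑ j ∈ Finset.range (2 ^ n), convPow ω j := by
  obtain ⟨φ, K, hφ, hK, hK1, hKinv, hle, hsub⟩ := hF.exists_subsequence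
  let F' : ℕ → Set G := fun n => K n ^ 2 ^ n * F (φ n) * K n ^ 2 ^ n
  have hF'c : ∀ n, IsCompact (F' n) := fun n =>
    ((isCompact_pow (hK n) _).mul (hF.isCompact _)).mul (isCompact_pow (hK n) _)
  have hFF' : ∀ n, F (φ n) ⊆ F' n := fun n x hx => by
    have := Set.mul_mem_mul (Set.mul_mem_mul (Set.one_mem_pow (n := 2 ^ n) (hK1 n)) hx)
      (Set.one_mem_pow (n := 2 ^ n) (hK1 n))
    rwa [one_mul, mul_one] at this
  have hpos : ∀ n, 0 < lam (F' n) := fun n =>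
    (hF.measure_pos _).trans_le (measure_mono (hFF' n))
  have hfin : ∀ n, lam (F' n) ≠ ∞ := fun n => (hF'c n).measure_lt_top.ne
  have hfinF : ∀ n, lam (F (φ n)) ≠ ∞ := fun n => (hF.isCompact _).measure_lt_top.ne
  let ν : ℕ → Measure G := fun n => ProbabilityTheory.cond lam (F' n)
  have hν : ∀ n, IsProbabilityMeasure (ν n) := fun n =>
    ProbabilityTheory.cond_isProbabilityMeasure_of_finite (hpos n).ne' (hfin n)
  let w : ℕ → ℝ≥0 := fun n => (1 / 2) ^ (n + 1)
  let ω : Measure G := Measure.sum fun n => w n • ν n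
  have hsumw : ∀ n, (∑ k ∈ Finset.range n, w k : ℝ≥0) + (1 / 2) ^ n = 1 := by
    intro n
    induction n with
    | zero => simp
    | succ n ih =>
      have h : (1 / 2 : ℝ≥0) ^ (n + 1) + (1 / 2) ^ (n + 1) = (1 / 2) ^ n := by
        rw [pow_succ, ← mul_add, add_halves, mul_one]
      rw [Finset.sum_range_succ, add_assoc]
      change _ + ((1 / 2 : ℝ≥0) ^ (n + 1) + (1 / 2) ^ (n + 1)) = 1
      rw [h, ih]
  have hωuniv : ω Set.univ = 1 := by
    rw [Measure.sum_apply _ MeasurableSet.univ]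
    have : ∀ n, (w n • ν n) Set.univ = (2⁻¹ : ℝ≥0∞) ^ (n + 1) := fun n => by
      rw [Measure.smul_apply, measure_univ, ENNReal.smul_def, smul_eq_mul, mul_one]
      simp only [w]
      push_cast
      rw [one_div]
    simp only [this]
    rw [ENNReal.tsum_geometric_add_one, ENNReal.one_sub_inv_two, inv_inv,
      ENNReal.inv_mul_cancel (by simp) (by simp)]
  have hωp : IsProbabilityMeasure ω := ⟨hωuniv⟩
  refine ⟨φ, ω, hφ, hωp, Measure.absolutelyContinuous_sum_left fun n =>
    (Measure.AbsolutelyContinuous.smul_left ProbabilityTheory.cond_absolutelyContinuous _),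
    fun n hn => ?_⟩
  let A : Measure G := ∑ k ∈ Finset.range n, w k • ν k
  have hAuniv : A Set.univ = ((∑ k ∈ Finset.range n, w k : ℝ≥0) : ℝ≥0∞) := by
    simp only [A, Measure.finsetSum_apply, Measure.smul_apply, measure_univ, ENNReal.smul_def,
      smul_eq_mul, mul_one]
    push_cast
    rfl
  have hAK : A (K n)ᶜ = 0 := by
    simp only [A, Measure.finsetSum_apply]
    refine Finset.sum_eq_zero fun k hk => ?_
    rw [Measure.smul_apply, ProbabilityTheory.cond_apply (hF'c k).measurableSet]
    have : F' k ∩ (K n)ᶜ = ∅ := by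
      rw [← Set.sdiff_eq, Set.sdiff_eq_empty]
      exact hsub k n (Finset.mem_range.1 hk)
    simp [this]
  -- the total mass of `A`, equal to `1 - 2⁻ⁿ`
  set a : ℝ≥0 := ∑ k ∈ Finset.range n, w k with ha
  set V' : ℝ≥0 := (lam (F' n)).toNNReal with hV'
  set V : ℝ≥0 := (lam (F (φ n))).toNNReal with hV
  have hV'c : (V' : ℝ≥0∞) = lam (F' n) := ENNReal.coe_toNNReal (hfin n)
  have hVc : (V : ℝ≥0∞) = lam (F (φ n)) := ENNReal.coe_toNNReal (hfinF n)
  have hV'0 : 0 < V' := by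
    have := hpos n
    rw [← hV'c] at this
    exact_mod_cast this
  have hV0 : 0 < V := by
    have := hF.measure_pos (φ n)
    rw [← hVc] at this
    exact_mod_cast this
  have hVV' : V' ≤ 2 * V := by
    have := hle n
    rw [← hVc] at this
    change lam (F' n) ≤ _ at this
    rw [← hV'c] at this
    exact_mod_cast this
  -- the density of the `n`-th summand of `ω` with respect to `lam` on `F' n`
  set b : ℝ≥0 := w n / V' with hb
  have hbν : b • lam.restrict (F' n) = w n • ν n := by
    have : ν n = V'⁻¹ • lam.restrict (F' n) := by
      change (lam (F' n))⁻¹ • lam.restrict (F' n) = _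
      rw [← hV'c, ← ENNReal.coe_inv hV'0.ne']
      rfl
    rw [this, smul_smul, hb, div_eq_mul_inv]
  have hω : A + b • lam.restrict (F' n) ≤ ω := by
    rw [hbν]
    have : A + w n • ν n = ∑ k ∈ Finset.range (n + 1), w k • ν k :=
      (Finset.sum_range_succ _ _).symm
    rw [this]
    refine Measure.le_iff.2 fun S hS => ?_
    rw [Measure.sum_apply _ hS, Measure.finsetSum_apply]
    exact ENNReal.sum_le_tsum _
  have hj : ∀ j ∈ Finset.range (2 ^ n),
      ((j : ℝ≥0∞) * a ^ (j - 1) * b) • lam.restrict (F (φ n)) ≤ convPow ω j := by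
    intro j hj
    have h := convPow_ge_of_le hω (hK n) (hK1 n) (hKinv n) hAK (F := F (φ n)) (m := 2 ^ n)
      (Set.Subset.refl _) (Finset.mem_range.1 hj).le
    rw [hAuniv] at h
    refine le_trans ?_ ((Measure.le_add_left le_rfl).trans h)
    gcongr
    intro x hx
    have := Set.mul_mem_mul (Set.one_mem_pow (n := 2 ^ n - j) (hK1 n)) hx
    rwa [one_mul] at this
  refine ⟨64 * V / 2 ^ n, ?_, ?_⟩
  · simp only [NNReal.coe_div, NNReal.coe_mul, NNReal.coe_pow, NNReal.coe_ofNat]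
    rfl
  have ha' : (a : ℝ) = 1 - (1 / 2) ^ n := by
    have := congrArg (NNReal.toReal) (hsumw n)
    push_cast at this
    rw [ha]
    push_cast
    linarith
  have hnum : 1 ≤ (64 * V / 2 ^ n) * ∑ j ∈ Finset.range (2 ^ n), (j : ℝ≥0) * a ^ (j - 1) * b := by
    have h := one_le_sum_weights hn (V := V) (V' := V') (by exact_mod_cast hV0)
      (by exact_mod_cast hV'0) (by exact_mod_cast hVV')
    rw [← NNReal.coe_le_coe]
    push_cast
    rw [ha', hb]
    simpa [w] using h
  have hnum' : (1 : ℝ≥0∞) ≤ ((64 * V / 2 ^ n : ℝ≥0) : ℝ≥0∞) *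
      ∑ j ∈ Finset.range (2 ^ n), (j : ℝ≥0∞) * a ^ (j - 1) * b := by
    exact_mod_cast hnum
  calc lam.restrict (F (φ n)) = (1 : ℝ≥0∞) • lam.restrict (F (φ n)) := (one_smul _ _).symm
    _ ≤ (((64 * V / 2 ^ n : ℝ≥0) : ℝ≥0∞) *
        ∑ j ∈ Finset.range (2 ^ n), (j : ℝ≥0∞) * a ^ (j - 1) * b) • lam.restrict (F (φ n)) := by
      gcongr
    _ = ((64 * V / 2 ^ n : ℝ≥0) : ℝ≥0∞) • ∑ j ∈ Finset.range (2 ^ n),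
        ((j : ℝ≥0∞) * a ^ (j - 1) * b) • lam.restrict (F (φ n)) := by
      rw [mul_smul, Finset.sum_smul]
    _ ≤ ((64 * V / 2 ^ n : ℝ≥0) : ℝ≥0∞) • ∑ j ∈ Finset.range (2 ^ n), convPow ω j := by
      gcongr with j hj'
      exact hj j hj'
    _ = _ := rfl

end Construction

/-! ### Comparison of Følner averages with Cesàro means -/

namespace TracePreservingAction

section Cesaro

variable {G : Type v} [Group G] [TopologicalSpace G] [IsTopologicalGroup G]
  [SecondCountableTopology G] [MeasurableSpace G] [BorelSpace G] {H : Type u}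
  [NormedAddCommGroup H] [InnerProductSpace ℂ H] [CompleteSpace H] {M : VonNeumannAlgebra H}
  {τ : SFNTrace M} (α : TracePreservingAction G τ)

theorem avg_convPow (ω : Measure G) [IsFiniteMeasure ω] (j : ℕ) (x : M) :
    α.avg (convPow ω j) x = (α.avg ω ^ j) x := by
  induction j with
  | zero => exact α.avg_dirac_one x
  | succ j ih =>
    rw [pow_succ', Module.End.mul_apply, ← ih]
    exact α.avg_mconv ω (convPow ω j) x

theorem avg_le_of_le_convPow {μ ω : Measure G} [IsFiniteMeasure μ] [IsFiniteMeasure ω] {c : ℝ≥0}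
    {n : ℕ} (h : μ ≤ c • ∑ j ∈ Finset.range n, convPow ω j) {x : M} (hx : 0 ≤ x) :
    α.avg μ x ≤ (c : ℝ) • ∑ j ∈ Finset.range n, (α.avg ω ^ j) x := by
  refine (α.avg_mono_measure h hx).trans_eq ?_
  rw [avg_smul_measure, avg_sum_measure]
  simp only [avg_convPow]

theorem lpAvg_convPow {p : ℝ} (hp : 1 ≤ p) (ω : Measure G) [IsFiniteMeasure ω] (j : ℕ)
    (v : τ.Lp p) : α.lpAvg hp (convPow ω j) v = (α.lpAvg hp ω ^ j) v := by
  induction j with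
  | zero => exact α.lpAvg_dirac_one hp v
  | succ j ih =>
    rw [pow_succ']
    change _ = α.lpAvg hp ω ((α.lpAvg hp ω ^ j) v)
    rw [← ih]
    exact α.lpAvg_mconv hp ω (convPow ω j) v

theorem lpLE_of_le_convPow {p : ℝ} (hp : 1 ≤ p) {μ ω : Measure G} [IsFiniteMeasure μ]
    [IsFiniteMeasure ω] {c : ℝ≥0} {n : ℕ} (h : μ ≤ c • ∑ j ∈ Finset.range n, convPow ω j)
    {v : τ.Lp p} (hv : v ∈ τ.LpPos p) :
    (c : ℝ) • ∑ j ∈ Finset.range n, (α.lpAvg hp ω ^ j) v - α.lpAvg hp μ v ∈ τ.LpPos p := by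
  have h1 := α.lpLE_lpAvg_of_le hp h hv
  have h2 : α.lpAvg hp (c • ∑ j ∈ Finset.range n, convPow ω j) v =
      (c : ℝ) • ∑ j ∈ Finset.range n, (α.lpAvg hp ω ^ j) v := by
    rw [lpAvg_apply, integral_smul_nnreal_measure,
      integral_finsetSum_measure fun j _ => α.integrable_onLp hp v _]
    simp only [← lpAvg_convPow, lpAvg_apply]
    rfl
  rwa [h2] at h1

end Cesaro

end TracePreservingAction


theorem mainTheorem1 {G : Type v} [Group G] [TopologicalSpace G] [IsTopologicalGroup G]
    [T2Space G] [LocallyCompactSpace G] [SecondCountableTopology G]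
    [MeasurableSpace G] [BorelSpace G]
    (lam : Measure G) [lam.IsHaarMeasure] [lam.IsMulRightInvariant]
    (F₀ : ℕ → Set G) (hF₀ : IsTwoSidedFolner lam F₀) :
    ∃ (φ : ℕ → ℕ) (C : ℝ) (N : ℕ → ℕ) (ω : Measure G) (n₀ : ℕ),
      StrictMono φ ∧ 0 < C ∧ StrictMono N ∧ IsProbabilityMeasure ω ∧ ω ≪ lam ∧
      ∀ (H : Type u) [NormedAddCommGroup H] [InnerProductSpace ℂ H] [CompleteSpace H]
        (M : VonNeumannAlgebra H) (τ : SFNTrace M) (α : TracePreservingAction G τ),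
        (∃ T : M →ₗ[ℂ] M,
          (∀ x, ‖T x‖ ≤ ‖x‖) ∧
          (∀ x, 0 ≤ x → 0 ≤ T x) ∧
          (∀ x, 0 ≤ x → τ (T x) ≤ τ x) ∧
          (∀ x, IsWeakStarIntegral (fun g => α g x) ω (T x)) ∧
          ∀ x, 0 ≤ x → ∀ n, n₀ ≤ n →
            ∃ a : M, IsWeakStarIntegral (fun g => α g x) (lam.restrict (F₀ (φ n))) a ∧
              (lam.real (F₀ (φ n)))⁻¹ • a ≤
                (C * (N n : ℝ)⁻¹) • ∑ j ∈ Finset.range (N n), (T ^ j) x) ∧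
        ∀ p : ℝ, 1 ≤ p → ∃ T : τ.Lp p →L[ℂ] τ.Lp p,
          (∀ x ∈ τ.LpPos p, T x ∈ τ.LpPos p) ∧
          (∀ x, Integrable (fun g => α.onLp p g x) ω ∧ T x = ∫ g, α.onLp p g x ∂ω) ∧
          ∀ x ∈ τ.LpPos p, ∀ n, n₀ ≤ n →
            IntegrableOn (fun g => α.onLp p g x) (F₀ (φ n)) lam ∧
              τ.LpLE p ((lam.real (F₀ (φ n)))⁻¹ • ∫ g in F₀ (φ n), α.onLp p g x ∂lam)
                ((C * (N n : ℝ)⁻¹) • ∑ j ∈ Finset.range (N n), (T ^ j) x) := by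
  obtain ⟨φ, ω, hφ, hω, hωlam, hdom⟩ := hF₀.exists_restrict_le_convPow
  have hfin : ∀ n, IsFiniteMeasure (lam.restrict (F₀ (φ n))) := fun n =>
    ⟨by rw [Measure.restrict_apply_univ]; exact (hF₀.isCompact _).measure_lt_top⟩
  have hpos : ∀ n, 0 < lam.real (F₀ (φ n)) := fun n =>
    ENNReal.toReal_pos (hF₀.measure_pos _).ne' (hF₀.isCompact _).measure_lt_top.ne
  have hscal : ∀ (n : ℕ) (c : ℝ≥0), (c : ℝ) = 64 * lam.real (F₀ (φ n)) / 2 ^ n →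
      (lam.real (F₀ (φ n)))⁻¹ * (c : ℝ) = 64 * (((2 ^ n : ℕ) : ℝ))⁻¹ := fun n c hc => by
    have := hpos n
    rw [hc]
    push_cast
    field_simp
  refine ⟨φ, 64, fun n => 2 ^ n, ω, 1, hφ, by norm_num, pow_right_strictMono₀ (by norm_num), hω,
    hωlam, fun H _ _ _ M τ α => ⟨⟨α.avg ω, fun x => ?_, fun x hx => α.avg_nonneg ω hx,
      fun x hx => α.trace_avg_le ω hx, α.isWeakStarIntegral_avg ω, fun x hx n hn =>
        ⟨α.avg (lam.restrict (F₀ (φ n))) x, α.isWeakStarIntegral_avg _ x, ?_⟩⟩,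
      fun p hp => ⟨α.lpAvg hp ω, fun v hv => α.lpAvg_mem_LpPos hp ω hv,
        fun v => ⟨α.integrable_onLp hp v ω, rfl⟩, fun v hv n hn =>
          ⟨α.integrable_onLp hp v _, ?_⟩⟩⟩⟩
  · have := α.norm_avg_le ω x
    rwa [probReal_univ, one_mul] at this
  · obtain ⟨c, hc, hle⟩ := hdom n hn
    have h := smul_le_smul_of_nonneg_left (α.avg_le_of_le_convPow hle hx)
      (inv_nonneg.2 (hpos n).le)
    rwa [smul_smul, hscal n c hc] at h
  · obtain ⟨c, hc, hle⟩ := hdom n hn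
    have h := τ.smul_mem_LpPos p (inv_nonneg.2 (hpos n).le) (α.lpLE_of_le_convPow hp hle hv)
    rw [smul_sub, smul_smul, hscal n c hc] at h
    exact h
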